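/- **Theorem 3.5 (Einstein version).** Let $\varphi:(M^m,g)\to(N^n,h)$ be an isometric immersion between smooth Riemannian manifolds, i.e. a smooth map with $h(d\varphi(u),d\varphi(v))=g(u,v)$ for all tangent vectors $u,v$ at a common point of $M$. Let $\nabla,\nabla^h$ be the Levi-Civita connections of $(M,g),(N,h)$, let $\overline\nabla$ be the connection on $\varphi^{-1}TN$ induced by $\nabla^h$, and let $R^h(U,V)W=\nabla^h_U\nabla^h_VW-\nabla^h_V\nabla^h_UW-\nabla^h_{[U,V]}W$. Let $B_\varphi(X,Y)=\overline\nabla_X(d\varphi(Y))-d\varphi(\nabla_XY)$ be the second fundamental form, $\tau(\varphi)=\sum_{i=1}^mB_\varphi(e_i,e_i)$ the tension field, where $\{e_i\}_{i=1}^m$ is a local orthonormal frame of $M$, and $\rho^h(u)=\sum_{i=1}^nR^h(u,e'_i)e'_i$ the Ricci transform, where $\{e'_i\}_{i=1}^n$ is a local orthonormal frame of $N$. The map $\varphi$ is called biharmonic if its bitension field $$\tau_2(\varphi)=-\sum_{i=1}^m\big\{\overline\nabla_{e_i}\overline\nabla_{e_i}\tau(\varphi)-\overline\nabla_{\nabla_{e_i}e_i}\tau(\varphi)\big\}-\sum_{i=1}^mR^h(\tau(\varphi),d\varphi(e_i))\,d\varphi(e_i)$$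 vanishes identically on $M$. Assume that the tension field is parallel for the normal connection: for every smooth vector field $X$ on $M$, the component $\overline\nabla^\perp_X\tau(\varphi)$ of $\overline\nabla_X\tau(\varphi)$ normal to $d\varphi(TM)$ is zero. For each $x\in M$ let $(e_j)_{j=1}^m$ be any orthonormal basis of $T_xM$ and let $(\xi_i)_{i=1}^{p}$, $p=n-m$, be any orthonormal basis of the orthogonal complement of $d\varphi_x(T_xM)$ in $T_{\varphi(x)}N$. 1. $\varphi$ is biharmonic if and only if, at every point of $M$, $$\rho^h(\tau(\varphi))-\sum_{i=1}^{p}R^h(\tau(\varphi),\xi_i)\xi_i=\sum_{j,k=1}^mh\big(\tau(\varphi),B_\varphi(e_j,e_k)\big)\,B_\varphi(e_j,e_k).$$ 2. If $(N,h)$ is Einstein in the sense that $\rho^h=c\,\mathrm{Id}$ for some constant $c\in\mathbb R$, then $\varphi$ is biharmonic if and only if, at every point of $M$, $$c\,\tau(\varphi)-\sum_{i=1}^{p}R^h(\tau(\varphi),\xi_i)\xi_i=\sum_{j,k=1}^mh\big(\tau(\varphi),B_\varphi(e_j,e_k)\big)\,B_\varphi(e_j,e_k).$$ -/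

import Mathlib

open Bundle
open scoped Manifold ContDiff InnerProductSpace

namespace RiemannianImmersion

noncomputable section

/-! ### The Levi-Civita connection, the curvature and the Ricci transform of a Riemannian manifold

`N` is a smooth manifold whose tangent bundle carries a Riemannian metric. For `u ∈ T_y N`,
`FiberBundle.extend F u` is the local vector field near `y` which is constant in the preferred chart
at `y` and has value `u` at `y` (a constant combination of coordinate vector fields). -/

section Intrinsic

variable {F : Type*} [NormedAddCommGroup F] [NormedSpace ℝ F] [FiniteDimensional ℝ F]
  {H' : Type*} [TopologicalSpace H'] {J : ModelWithCorners ℝ F H'}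
  {N : Type*} [TopologicalSpace N] [ChartedSpace H' N] [IsManifold J ∞ N]
  [RiemannianBundle (fun y : N ↦ TangentSpace J y)]

instance finiteDimensionalTangentSpace (y : N) : FiniteDimensional ℝ (TangentSpace J y) :=
  inferInstanceAs (FiniteDimensional ℝ F)

/-- The standard Mathlib orthonormal basis of the tangent space `T_y N`. -/
def tangentONB (y : N) :
    OrthonormalBasis (Fin (Module.finrank ℝ (TangentSpace J y))) ℝ (TangentSpace J y) :=
  stdOrthonormalBasis ℝ (TangentSpace J y)

/-- The Koszul formula for coordinate fields (whose Lie brackets vanish): with `U, V, Z` the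
coordinate extensions of `u, v, z`, this is
`⟨∇_U V, Z⟩ = (U⟨V, Z⟩ + V⟨U, Z⟩ - Z⟨U, V⟩) / 2` at `y`, i.e. the Christoffel symbol of the first
kind in the preferred chart at `y`. -/
def christoffelFirst (y : N) (u v z : TangentSpace J y) : ℝ :=
  let U := FiberBundle.extend F u
  let V := FiberBundle.extend F v
  let Z := FiberBundle.extend F z
  (d% (fun p : N ↦ ⟪V p, Z p⟫_ℝ) y u + d% (fun p : N ↦ ⟪U p, Z p⟫_ℝ) y v
    - d% (fun p : N ↦ ⟪U p, V p⟫_ℝ) y z) / 2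

/-- The Christoffel symbol `Γ(u, v) = (∇_U V)(y)` of the second kind, in the preferred chart at `y`:
the vector with `⟨Γ(u, v), z⟩ = christoffelFirst y u v z` for all `z`. -/
def christoffel (y : N) (u v : TangentSpace J y) : TangentSpace J y :=
  ∑ i, christoffelFirst y u v (tangentONB y i) • tangentONB y i

/-- The Levi-Civita covariant derivative `∇_u W` at `y` of a vector field `W` in the direction
`u ∈ T_y N`: in the preferred chart at `y` it is `dW(u) + Γ(u, W)`. -/
def leviCivita (W : ∀ y : N, TangentSpace J y) (y : N) (u : TangentSpace J y) :
    TangentSpace J y :=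
  let t := trivializationAt F (fun p : N ↦ TangentSpace J p) y
  t.symm y (d% (fun p : N ↦ (t ⟨p, W p⟩).2) y u) + christoffel y u (W y)

/-- `R(U, V)W = ∇_U ∇_V W - ∇_V ∇_U W - ∇_{[U, V]} W` for vector fields `U, V, W`. -/
def curvatureField (U V W : ∀ y : N, TangentSpace J y) (y : N) : TangentSpace J y :=
  leviCivita (fun p ↦ leviCivita W p (V p)) y (U y)
    - leviCivita (fun p ↦ leviCivita W p (U p)) y (V y)
    - leviCivita W y (VectorField.mlieBracket J U V y)

/-- The curvature tensor `R(u, v)w` at `y`; `curvatureField` is tensorial, so it is evaluated on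
tangent vectors by extending them to local vector fields. -/
def curvature (y : N) (u v w : TangentSpace J y) : TangentSpace J y :=
  curvatureField (FiberBundle.extend F u) (FiberBundle.extend F v) (FiberBundle.extend F w) y

/-- The Ricci transform `ρ(u) = ∑ i, R(u, e'ᵢ)e'ᵢ`, with `e'` an orthonormal basis of `T_y N`. -/
def ricciTransform (y : N) (u : TangentSpace J y) : TangentSpace J y :=
  ∑ i, curvature y u (tangentONB y i) (tangentONB y i)

end Intrinsic

/-! ### Maps between Riemannian manifolds -/

section Maps

variable {E : Type*} [NormedAddCommGroup E] [NormedSpace ℝ E] [FiniteDimensional ℝ E]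
  {H : Type*} [TopologicalSpace H] (I : ModelWithCorners ℝ E H)
  {M : Type*} [TopologicalSpace M] [ChartedSpace H M] [IsManifold I ∞ M]
  [RiemannianBundle (fun x : M ↦ TangentSpace I x)]
  {F : Type*} [NormedAddCommGroup F] [NormedSpace ℝ F] [FiniteDimensional ℝ F]
  {H' : Type*} [TopologicalSpace H'] (J : ModelWithCorners ℝ F H')
  {N : Type*} [TopologicalSpace N] [ChartedSpace H' N] [IsManifold J ∞ N]
  [RiemannianBundle (fun y : N ↦ TangentSpace J y)]

/-- A smooth map `φ` with `⟨dφ u, dφ v⟩ = ⟨u, v⟩` (so that `dφ` is injective at every point). -/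
structure IsIsometricImmersion (φ : M → N) : Prop where
  contMDiff : ContMDiff I J ∞ φ
  inner_mfderiv (x : M) (u v : TangentSpace I x) :
    ⟪mfderiv I J φ x u, mfderiv I J φ x v⟫_ℝ = ⟪u, v⟫_ℝ

/-- The connection `∇̄` induced by the Levi-Civita connection of `N` on `φ⁻¹TN`: the covariant
derivative `∇̄_u V` at `x`, in the direction `u ∈ T_x M`, of a vector field `V` along `φ`. In the
preferred chart at `φ x` it is `dV(u) + Γ(dφ u, V)`. -/
def pullbackCov (φ : M → N) (V : ∀ x : M, TangentSpace J (φ x)) (x : M) (u : TangentSpace I x) :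
    TangentSpace J (φ x) :=
  let t := trivializationAt F (fun p : N ↦ TangentSpace J p) (φ x)
  t.symm (φ x) (d% (fun p : M ↦ (t ⟨φ p, V p⟩).2) x u) + christoffel (φ x) (mfderiv I J φ x u) (V x)

/-- `B_φ(X, Y) = ∇̄_X (dφ Y) - dφ(∇_X Y)` for vector fields `X, Y` on `M`. -/
def secondFundamentalField (φ : M → N) (X Y : ∀ x : M, TangentSpace I x) (x : M) :
    TangentSpace J (φ x) :=
  pullbackCov I J φ (fun p ↦ mfderiv I J φ p (Y p)) x (X x)
    - mfderiv I J φ x (leviCivita Y x (X x))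

/-- The second fundamental form `B_φ(u, v)` on tangent vectors at `x` (`secondFundamentalField` is
tensorial). -/
def secondFundamentalForm (φ : M → N) (x : M) (u v : TangentSpace I x) : TangentSpace J (φ x) :=
  secondFundamentalField I J φ (FiberBundle.extend E u) (FiberBundle.extend E v) x

/-- The tension field `τ(φ) = ∑ i, B_φ(eᵢ, eᵢ)`. -/
def tensionField (φ : M → N) (x : M) : TangentSpace J (φ x) :=
  ∑ i, secondFundamentalForm I J φ x (tangentONB x i) (tangentONB x i)

/-- The second covariant derivative `∇̄_X ∇̄_Y V - ∇̄_{∇_X Y} V` of a vector field `V` along `φ`. -/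
def secondCov (φ : M → N) (V : ∀ x : M, TangentSpace J (φ x)) (X Y : ∀ x : M, TangentSpace I x)
    (x : M) : TangentSpace J (φ x) :=
  pullbackCov I J φ (fun p ↦ pullbackCov I J φ V p (Y p)) x (X x)
    - pullbackCov I J φ V x (leviCivita Y x (X x))

/-- The rough Laplacian `Δ̄V = -∑ i, (∇̄_{eᵢ} ∇̄_{eᵢ} V - ∇̄_{∇_{eᵢ} eᵢ} V)`. The summand is tensorial
in the two vector fields, so only the values at `x` of the fields matter; these form an orthonormal
basis of `T_x M`. -/
def roughLaplacian (φ : M → N) (V : ∀ x : M, TangentSpace J (φ x)) (x : M) :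
    TangentSpace J (φ x) :=
  -∑ i, secondCov I J φ V (FiberBundle.extend E (tangentONB (J := I) x i))
    (FiberBundle.extend E (tangentONB (J := I) x i)) x

/-- `ℛ(V) = ∑ i, R(V, dφ(eᵢ)) dφ(eᵢ)`. -/
def curvatureTrace (φ : M → N) (V : ∀ x : M, TangentSpace J (φ x)) (x : M) :
    TangentSpace J (φ x) :=
  ∑ i, curvature (φ x) (V x) (mfderiv I J φ x (tangentONB x i))
    (mfderiv I J φ x (tangentONB x i))

/-- The bitension field `τ₂(φ) = Δ̄ τ(φ) - ℛ(τ(φ))`. -/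
def bitensionField (φ : M → N) (x : M) : TangentSpace J (φ x) :=
  roughLaplacian I J φ (tensionField I J φ) x - curvatureTrace I J φ (tensionField I J φ) x

/-- A map is biharmonic if its bitension field vanishes identically. -/
def IsBiharmonic (φ : M → N) : Prop :=
  ∀ x : M, bitensionField I J φ x = 0

/-- The normal space at `x`: the orthogonal complement of `dφ(T_x M)` in `T_{φ x} N`. -/
def normalSpace (φ : M → N) (x : M) : Submodule ℝ (TangentSpace J (φ x)) :=
  (LinearMap.range (mfderiv I J φ x).toLinearMap)ᗮ

/-- The normal part `∇̄^⊥_u V` of `∇̄_u V`. -/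
def normalCov (φ : M → N) (V : ∀ x : M, TangentSpace J (φ x)) (x : M) (u : TangentSpace I x) :
    TangentSpace J (φ x) :=
  (normalSpace I J φ x).starProjection (pullbackCov I J φ V x u)

/-- The tension field is parallel for the normal connection: `∇̄^⊥_X τ(φ) = 0` for all smooth vector
fields `X` on `M`. -/
def HasParallelTension (φ : M → N) : Prop :=
  ∀ X : ∀ x : M, TangentSpace I x, ContMDiff I I.tangent ∞ (fun x ↦ (⟨x, X x⟩ : TangentBundle I M)) →
    ∀ x : M, normalCov I J φ (tensionField I J φ) x (X x) = 0

end Maps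

end

end RiemannianImmersion

open RiemannianImmersion

open scoped Topology

namespace RiemannianImmersion

noncomputable section

set_option linter.unusedSectionVars false

section Coordinates

variable {E : Type*} [NormedAddCommGroup E] [NormedSpace ℝ E]
  {H : Type*} [TopologicalSpace H] {I : ModelWithCorners ℝ E H}
  {M : Type*} [TopologicalSpace M] [ChartedSpace H M]
  {F : Type*} [NormedAddCommGroup F] [NormedSpace ℝ F]
  {H' : Type*} [TopologicalSpace H'] {J : ModelWithCorners ℝ F H'}
  {N : Type*} [TopologicalSpace N] [ChartedSpace H' N] [IsManifold J ∞ N]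
  {φ : M → N} {x : M} {k : ℕ∞ω}

variable (I) in
/-- The vector field `V` along `φ` is `C^k` at `x`. -/
def SmoothAlong (k : ℕ∞ω) (φ : M → N) (V : ∀ p, TangentSpace J (φ p)) (x : M) : Prop :=
  ContMDiffAt I J.tangent k (fun p ↦ (⟨φ p, V p⟩ : TangentBundle J N)) x

variable (I) in
/-- The vector field `V` along `φ` is differentiable at `x`. -/
def DiffAlong (φ : M → N) (V : ∀ p, TangentSpace J (φ p)) (x : M) : Prop :=
  MDifferentiableAt I J.tangent (fun p ↦ (⟨φ p, V p⟩ : TangentBundle J N)) x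

/-- The coordinate representation near `x` of a vector field along `φ` in the preferred chart
at `φ x`. -/
def coordAlong (φ : M → N) (V : ∀ p, TangentSpace J (φ p)) (x : M) : M → F :=
  fun p ↦ (trivializationAt F (fun q : N ↦ TangentSpace J q) (φ x) ⟨φ p, V p⟩).2

variable (k) in
/-- The vector field `W` on `N` is `C^k` at `y`. -/
abbrev SmoothField (W : ∀ y : N, TangentSpace J y) (y : N) : Prop :=
  SmoothAlong J k (fun q ↦ q) W y

/-- The vector field `W` on `N` is differentiable at `y`. -/
abbrev DiffField (W : ∀ y : N, TangentSpace J y) (y : N) : Prop :=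
  DiffAlong J (fun q ↦ q) W y

theorem diffAlong_iff {V : ∀ p, TangentSpace J (φ p)} :
    DiffAlong I φ V x ↔ MDifferentiableAt I J φ x ∧
      MDifferentiableAt I 𝓘(ℝ, F) (coordAlong φ V x) x :=
  mdifferentiableAt_totalSpace _ _

theorem smoothAlong_iff {V : ∀ p, TangentSpace J (φ p)} :
    SmoothAlong I k φ V x ↔ ContMDiffAt I J k φ x ∧
      ContMDiffAt I 𝓘(ℝ, F) k (coordAlong φ V x) x :=
  contMDiffAt_totalSpace

theorem SmoothAlong.diffAlong {V : ∀ p, TangentSpace J (φ p)} (h : SmoothAlong I k φ V x)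
    (hk : k ≠ 0) : DiffAlong I φ V x :=
  ContMDiffAt.mdifferentiableAt h hk

theorem eventually_mem_baseSet (hφ : ContinuousAt φ x) :
    ∀ᶠ p in 𝓝 x, φ p ∈ (trivializationAt F (fun q : N ↦ TangentSpace J q) (φ x)).baseSet :=
  hφ.eventually ((trivializationAt F (fun q : N ↦ TangentSpace J q) (φ x)).open_baseSet.mem_nhds
    (mem_baseSet_trivializationAt F (fun q : N ↦ TangentSpace J q) (φ x)))

theorem coordAlong_add {V W : ∀ p, TangentSpace J (φ p)} (hφ : ContinuousAt φ x) :
    coordAlong φ (fun p ↦ V p + W p) x =ᶠ[𝓝 x]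
      fun p ↦ coordAlong φ V x p + coordAlong φ W x p := by
  filter_upwards [eventually_mem_baseSet (J := J) hφ] with p hp
  exact ((trivializationAt F (fun q : N ↦ TangentSpace J q) (φ x)).linear ℝ hp).map_add _ _

theorem coordAlong_smul {V : ∀ p, TangentSpace J (φ p)} {f : M → ℝ} (hφ : ContinuousAt φ x) :
    coordAlong φ (fun p ↦ f p • V p) x =ᶠ[𝓝 x] fun p ↦ f p • coordAlong φ V x p := by
  filter_upwards [eventually_mem_baseSet (J := J) hφ] with p hp
  exact ((trivializationAt F (fun q : N ↦ TangentSpace J q) (φ x)).linear ℝ hp).map_smul _ _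

theorem coordAlong_zero (hφ : ContinuousAt φ x) :
    coordAlong φ (fun p ↦ (0 : TangentSpace J (φ p))) x =ᶠ[𝓝 x] fun _ ↦ 0 := by
  filter_upwards [eventually_mem_baseSet (J := J) hφ] with p hp
  exact ((trivializationAt F (fun q : N ↦ TangentSpace J q) (φ x)).linear ℝ hp).map_zero

theorem coordAlong_congr {V W : ∀ p, TangentSpace J (φ p)} (h : ∀ᶠ p in 𝓝 x, V p = W p) :
    coordAlong φ V x =ᶠ[𝓝 x] coordAlong φ W x := by
  filter_upwards [h] with p hp
  simp [coordAlong, hp]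

theorem SmoothAlong.congr {V W : ∀ p, TangentSpace J (φ p)} (hV : SmoothAlong I k φ V x)
    (h : ∀ᶠ p in 𝓝 x, W p = V p) : SmoothAlong I k φ W x :=
  ContMDiffAt.congr_of_eventuallyEq hV (by filter_upwards [h] with p hp; rw [hp])

theorem DiffAlong.continuousAt {V : ∀ p, TangentSpace J (φ p)} (hV : DiffAlong I φ V x) :
    ContinuousAt φ x := (diffAlong_iff.1 hV).1.continuousAt

theorem SmoothAlong.continuousAt {V : ∀ p, TangentSpace J (φ p)} (hV : SmoothAlong I k φ V x) :
    ContinuousAt φ x := (smoothAlong_iff.1 hV).1.continuousAt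

theorem SmoothAlong.add {V W : ∀ p, TangentSpace J (φ p)} (hV : SmoothAlong I k φ V x)
    (hW : SmoothAlong I k φ W x) : SmoothAlong I k φ (fun p ↦ V p + W p) x :=
  smoothAlong_iff.2 ⟨(smoothAlong_iff.1 hV).1, ((smoothAlong_iff.1 hV).2.add
    (smoothAlong_iff.1 hW).2).congr_of_eventuallyEq (coordAlong_add hV.continuousAt)⟩

theorem SmoothAlong.smul {V : ∀ p, TangentSpace J (φ p)} {f : M → ℝ}
    (hf : ContMDiffAt I 𝓘(ℝ) k f x) (hV : SmoothAlong I k φ V x) :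
    SmoothAlong I k φ (fun p ↦ f p • V p) x :=
  smoothAlong_iff.2 ⟨(smoothAlong_iff.1 hV).1, (hf.smul
    (smoothAlong_iff.1 hV).2).congr_of_eventuallyEq (coordAlong_smul hV.continuousAt)⟩

theorem smoothAlong_zero (hφ : ContMDiffAt I J k φ x) :
    SmoothAlong I k φ (fun p ↦ (0 : TangentSpace J (φ p))) x :=
  smoothAlong_iff.2 ⟨hφ, contMDiffAt_const.congr_of_eventuallyEq
    (coordAlong_zero hφ.continuousAt)⟩

theorem SmoothAlong.sum {ι : Type*} (s : Finset ι) {V : ι → ∀ p, TangentSpace J (φ p)}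
    (hφ : ContMDiffAt I J k φ x) (hV : ∀ i ∈ s, SmoothAlong I k φ (V i) x) :
    SmoothAlong I k φ (fun p ↦ ∑ i ∈ s, V i p) x := by
  classical
  induction s using Finset.induction_on with
  | empty => simpa using smoothAlong_zero hφ
  | insert a s ha ih =>
    simp only [Finset.sum_insert ha]
    exact (hV a (by simp)).add (ih fun i hi ↦ hV i (by simp [hi]))

theorem SmoothAlong.neg {V : ∀ p, TangentSpace J (φ p)} (hV : SmoothAlong I k φ V x) :
    SmoothAlong I k φ (fun p ↦ - V p) x := by
  refine (hV.smul (f := fun _ ↦ -1) contMDiffAt_const).congr (.of_forall fun p ↦ by simp)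

theorem SmoothAlong.sub {V W : ∀ p, TangentSpace J (φ p)} (hV : SmoothAlong I k φ V x)
    (hW : SmoothAlong I k φ W x) : SmoothAlong I k φ (fun p ↦ V p - W p) x := by
  simpa only [sub_eq_add_neg] using hV.add hW.neg

theorem DiffAlong.add {V W : ∀ p, TangentSpace J (φ p)} (hV : DiffAlong I φ V x)
    (hW : DiffAlong I φ W x) : DiffAlong I φ (fun p ↦ V p + W p) x :=
  diffAlong_iff.2 ⟨(diffAlong_iff.1 hV).1, ((diffAlong_iff.1 hV).2.add
    (diffAlong_iff.1 hW).2).congr_of_eventuallyEq (coordAlong_add hV.continuousAt)⟩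

theorem DiffAlong.smul {V : ∀ p, TangentSpace J (φ p)} {f : M → ℝ}
    (hf : MDifferentiableAt I 𝓘(ℝ) f x) (hV : DiffAlong I φ V x) :
    DiffAlong I φ (fun p ↦ f p • V p) x :=
  diffAlong_iff.2 ⟨(diffAlong_iff.1 hV).1, (hf.smul
    (diffAlong_iff.1 hV).2).congr_of_eventuallyEq (coordAlong_smul hV.continuousAt)⟩

theorem diffAlong_zero (hφ : MDifferentiableAt I J φ x) :
    DiffAlong I φ (fun p ↦ (0 : TangentSpace J (φ p))) x :=
  diffAlong_iff.2 ⟨hφ, mdifferentiableAt_const.congr_of_eventuallyEq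
    (coordAlong_zero hφ.continuousAt)⟩

theorem DiffAlong.sum {ι : Type*} (s : Finset ι) {V : ι → ∀ p, TangentSpace J (φ p)}
    (hφ : MDifferentiableAt I J φ x) (hV : ∀ i ∈ s, DiffAlong I φ (V i) x) :
    DiffAlong I φ (fun p ↦ ∑ i ∈ s, V i p) x := by
  classical
  induction s using Finset.induction_on with
  | empty => simpa using diffAlong_zero hφ
  | insert a s ha ih =>
    simp only [Finset.sum_insert ha]
    exact (hV a (by simp)).add (ih fun i hi ↦ hV i (by simp [hi]))

/-- Restricting a smooth vector field on `N` to `φ`. -/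
theorem SmoothAlong.comp_map {W : ∀ y : N, TangentSpace J y} (hφ : ContMDiffAt I J k φ x)
    (hW : SmoothField k W (φ x)) : SmoothAlong I k φ (fun p ↦ W (φ p)) x :=
  ContMDiffAt.comp (g := fun q ↦ (⟨q, W q⟩ : TangentBundle J N)) x hW hφ

theorem DiffAlong.comp_map {W : ∀ y : N, TangentSpace J y} (hφ : MDifferentiableAt I J φ x)
    (hW : DiffField W (φ x)) : DiffAlong I φ (fun p ↦ W (φ p)) x :=
  MDifferentiableAt.comp (g := fun q ↦ (⟨q, W q⟩ : TangentBundle J N)) x hW hφ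

theorem smoothAlong_extend {y : N} (v : TangentSpace J y) :
    SmoothField ∞ (FiberBundle.extend F v) y :=
  FiberBundle.contMDiffAt_extend J F v

theorem SmoothAlong.of_le {l : ℕ∞ω} {V : ∀ p, TangentSpace J (φ p)}
    (hV : SmoothAlong I k φ V x) (h : l ≤ k) : SmoothAlong I l φ V x :=
  ContMDiffAt.of_le hV h

theorem SmoothAlong.eventually [IsManifold I ∞ M] {V : ∀ p, TangentSpace J (φ p)}
    (hV : SmoothAlong I ∞ φ V x) (n : ℕ) : ∀ᶠ p in 𝓝 x, SmoothAlong I n φ V p :=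
  haveI : IsManifold J (n + 1) N := inferInstanceAs (IsManifold J ((n + 1 : ℕ) : ℕ∞ω) N)
  (contMDiffAt_iff_contMDiffAt_nhds (by simp)).1 (ContMDiffAt.of_le hV (by exact_mod_cast le_top))

end Coordinates

section Extend

variable {F : Type*} [NormedAddCommGroup F] [NormedSpace ℝ F]
  {H' : Type*} [TopologicalSpace H'] {J : ModelWithCorners ℝ F H'}
  {N : Type*} [TopologicalSpace N] [ChartedSpace H' N] [IsManifold J ∞ N]

theorem trivialization_symm_add {y q : N}
    (hq : q ∈ (trivializationAt F (fun q : N ↦ TangentSpace J q) y).baseSet) (a b : F) :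
    (trivializationAt F (fun q : N ↦ TangentSpace J q) y).symm q (a + b) =
      (trivializationAt F (fun q : N ↦ TangentSpace J q) y).symm q a +
      (trivializationAt F (fun q : N ↦ TangentSpace J q) y).symm q b := by
  rw [← Trivialization.coe_symmₗ (R := ℝ) _ hq, map_add]

theorem trivialization_symm_smul {y q : N}
    (hq : q ∈ (trivializationAt F (fun q : N ↦ TangentSpace J q) y).baseSet) (c : ℝ) (a : F) :
    (trivializationAt F (fun q : N ↦ TangentSpace J q) y).symm q (c • a) =
      c • (trivializationAt F (fun q : N ↦ TangentSpace J q) y).symm q a := by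
  rw [← Trivialization.coe_symmₗ (R := ℝ) _ hq, map_smul]

theorem trivialization_symm_sum {ι : Type*} [Fintype ι] {y q : N}
    (hq : q ∈ (trivializationAt F (fun q : N ↦ TangentSpace J q) y).baseSet) (a : ι → F) :
    (trivializationAt F (fun q : N ↦ TangentSpace J q) y).symm q (∑ i, a i) =
      ∑ i, (trivializationAt F (fun q : N ↦ TangentSpace J q) y).symm q (a i) := by
  rw [← Trivialization.coe_symmₗ (R := ℝ) _ hq, map_sum]

theorem extend_add {y : N} (u v : TangentSpace J y) :
    ∀ᶠ q in 𝓝 y, FiberBundle.extend F (u + v) q =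
      FiberBundle.extend F u q + FiberBundle.extend F v q := by
  filter_upwards [eventually_mem_baseSet (J := J) (φ := fun q : N ↦ q) continuousAt_id] with q hq
  have h := ((trivializationAt F (fun q : N ↦ TangentSpace J q) y).linear ℝ
    (mem_baseSet_trivializationAt F (fun q : N ↦ TangentSpace J q) y)).map_add u v
  simp only [FiberBundle.extend, h]
  exact trivialization_symm_add hq _ _

theorem extend_smul {y : N} (c : ℝ) (v : TangentSpace J y) :
    ∀ᶠ q in 𝓝 y, FiberBundle.extend F (c • v) q = c • FiberBundle.extend F v q := by
  filter_upwards [eventually_mem_baseSet (J := J) (φ := fun q : N ↦ q) continuousAt_id] with q hq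
  have h := ((trivializationAt F (fun q : N ↦ TangentSpace J q) y).linear ℝ
    (mem_baseSet_trivializationAt F (fun q : N ↦ TangentSpace J q) y)).map_smul c v
  simp only [FiberBundle.extend, h]
  exact trivialization_symm_smul hq _ _

end Extend

section Expansion

variable {E : Type*} [NormedAddCommGroup E] [NormedSpace ℝ E]
  {H : Type*} [TopologicalSpace H] {I : ModelWithCorners ℝ E H}
  {M : Type*} [TopologicalSpace M] [ChartedSpace H M]
  {F : Type*} [NormedAddCommGroup F] [NormedSpace ℝ F] [FiniteDimensional ℝ F]
  {H' : Type*} [TopologicalSpace H'] {J : ModelWithCorners ℝ F H'}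
  {N : Type*} [TopologicalSpace N] [ChartedSpace H' N] [IsManifold J ∞ N]
  {φ : M → N} {x : M} {k : ℕ∞ω}

variable (J) in
/-- The coordinate basis of `T_y N` in the preferred chart at `y`. -/
def chartVec (y : N) (i : Fin (Module.finrank ℝ F)) : TangentSpace J y :=
  (trivializationAt F (fun q : N ↦ TangentSpace J q) y).symm y (Module.finBasis ℝ F i)

/-- The components of a vector field along `φ` in the preferred chart at `φ x`. -/
def chartCoeff (φ : M → N) (V : ∀ p, TangentSpace J (φ p)) (x : M)
    (i : Fin (Module.finrank ℝ F)) (p : M) : ℝ :=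
  (Module.finBasis ℝ F).coord i (coordAlong φ V x p)

theorem extend_chartVec (y : N) (i : Fin (Module.finrank ℝ F)) (q : N) :
    FiberBundle.extend F (chartVec J y i) q =
      (trivializationAt F (fun q : N ↦ TangentSpace J q) y).symm q (Module.finBasis ℝ F i) := by
  have h := (trivializationAt F (fun q : N ↦ TangentSpace J q) y).apply_mk_symm
    (mem_baseSet_trivializationAt F (fun q : N ↦ TangentSpace J q) y) (Module.finBasis ℝ F i)
  simp only [FiberBundle.extend, chartVec, h]

theorem eventually_eq_sum_chartCoeff (hφ : ContinuousAt φ x) (V : ∀ p, TangentSpace J (φ p)) :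
    ∀ᶠ p in 𝓝 x, V p =
      ∑ i, chartCoeff φ V x i p • FiberBundle.extend F (chartVec J (φ x) i) (φ p) := by
  filter_upwards [eventually_mem_baseSet (J := J) hφ] with p hp
  simp only [extend_chartVec, chartCoeff, ← trivialization_symm_smul hp,
    ← trivialization_symm_sum hp,
    Module.Basis.coord_apply, Module.Basis.sum_repr]
  exact ((trivializationAt F (fun q : N ↦ TangentSpace J q) (φ x)).symm_apply_apply_mk hp
    (V p)).symm

theorem SmoothAlong.chartCoeff {V : ∀ p, TangentSpace J (φ p)} (hV : SmoothAlong I k φ V x)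
    (i : Fin (Module.finrank ℝ F)) : ContMDiffAt I 𝓘(ℝ) k (chartCoeff φ V x i) x :=
  (LinearMap.toContinuousLinearMap
    ((Module.finBasis ℝ F).coord i)).contMDiff.contMDiffAt.comp x (smoothAlong_iff.1 hV).2

theorem DiffAlong.chartCoeff {V : ∀ p, TangentSpace J (φ p)} (hV : DiffAlong I φ V x)
    (i : Fin (Module.finrank ℝ F)) : MDifferentiableAt I 𝓘(ℝ) (chartCoeff φ V x i) x :=
  (LinearMap.toContinuousLinearMap
    ((Module.finBasis ℝ F).coord i)).mdifferentiable.mdifferentiableAt.comp x (diffAlong_iff.1 hV).2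

end Expansion

theorem mvfderiv_congr {E H M G : Type*} [NormedAddCommGroup E] [NormedSpace ℝ E]
    [TopologicalSpace H] {I : ModelWithCorners ℝ E H} [TopologicalSpace M] [ChartedSpace H M]
    [NormedAddCommGroup G] [NormedSpace ℝ G] {f g : M → G} {x : M}
    (h : f =ᶠ[𝓝 x] g) : d% f x = d% g x := by
  ext v
  simp only [mvfderiv, ContinuousLinearMap.comp_apply]
  rw [h.mfderiv_eq]
  rfl

section Christoffel

variable {F : Type*} [NormedAddCommGroup F] [NormedSpace ℝ F] [FiniteDimensional ℝ F]
  {H' : Type*} [TopologicalSpace H'] {J : ModelWithCorners ℝ F H'}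
  {N : Type*} [TopologicalSpace N] [ChartedSpace H' N] [IsManifold J ∞ N]
  [RiemannianBundle (fun y : N ↦ TangentSpace J y)]
  [IsContMDiffRiemannianBundle J ∞ F (fun y : N ↦ TangentSpace J y)]

theorem diffField_extend {y : N} (v : TangentSpace J y) :
    DiffField (J := J) (FiberBundle.extend F v) y :=
  (smoothAlong_extend v).diffAlong (by simp)

theorem DiffField.inner {y : N} {V W : ∀ y : N, TangentSpace J y} (hV : DiffField V y)
    (hW : DiffField W y) : MDifferentiableAt J 𝓘(ℝ) (fun q ↦ ⟪V q, W q⟫_ℝ) y :=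
  MDifferentiableAt.inner_bundle (b := fun q : N ↦ q) hV hW

/-- The derivative of the metric coefficients in the preferred chart at `y`. -/
def metricDeriv (y : N) (u v w : TangentSpace J y) : ℝ :=
  d% (fun q : N ↦ ⟪(FiberBundle.extend F v : ∀ q : N, TangentSpace J q) q,
    FiberBundle.extend F w q⟫_ℝ) y u

theorem metricDeriv_comm (y : N) (u v w : TangentSpace J y) :
    metricDeriv y u v w = metricDeriv y u w v := by
  simp only [metricDeriv, real_inner_comm]

theorem metricDeriv_add_right (y : N) (u v w w' : TangentSpace J y) :
    metricDeriv y u v (w + w') = metricDeriv y u v w + metricDeriv y u v w' := by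
  simp only [metricDeriv]
  rw [mvfderiv_congr ((extend_add w w').mono fun q hq ↦ by
      rw [hq, inner_add_right]),
    mvfderiv_fun_add ((diffField_extend v).inner (diffField_extend w))
    ((diffField_extend v).inner (diffField_extend w'))]
  rfl

theorem metricDeriv_smul_right (y : N) (u v w : TangentSpace J y) (c : ℝ) :
    metricDeriv y u v (c • w) = c * metricDeriv y u v w := by
  simp only [metricDeriv]
  rw [mvfderiv_congr ((extend_smul c w).mono fun q hq ↦ by
      rw [hq, inner_smul_right]),
    mvfderiv_fun_mul mdifferentiableAt_const ((diffField_extend v).inner (diffField_extend w)),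
    mvfderiv_const]
  simp

theorem metricDeriv_add_mid (y : N) (u v v' w : TangentSpace J y) :
    metricDeriv y u (v + v') w = metricDeriv y u v w + metricDeriv y u v' w := by
  simp only [metricDeriv_comm y u _ w, metricDeriv_add_right]

theorem metricDeriv_smul_mid (y : N) (u v w : TangentSpace J y) (c : ℝ) :
    metricDeriv y u (c • v) w = c * metricDeriv y u v w := by
  simp only [metricDeriv_comm y u _ w, metricDeriv_smul_right]

theorem metricDeriv_add_left (y : N) (u u' v w : TangentSpace J y) :
    metricDeriv y (u + u') v w = metricDeriv y u v w + metricDeriv y u' v w :=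
  map_add _ _ _

theorem metricDeriv_smul_left (y : N) (u v w : TangentSpace J y) (c : ℝ) :
    metricDeriv y (c • u) v w = c * metricDeriv y u v w :=
  map_smul _ _ _

theorem christoffelFirst_eq (y : N) (u v w : TangentSpace J y) :
    christoffelFirst y u v w =
      (metricDeriv y u v w + metricDeriv y v u w - metricDeriv y w u v) / 2 :=
  rfl

theorem inner_christoffel (y : N) (u v w : TangentSpace J y) :
    ⟪christoffel y u v, w⟫_ℝ = christoffelFirst y u v w := by
  let L : TangentSpace J y →ₗ[ℝ] ℝ :=
    { toFun := christoffelFirst y u v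
      map_add' := fun a b ↦ by
        simp only [christoffelFirst_eq, metricDeriv_add_right, metricDeriv_add_left]; ring
      map_smul' := fun c a ↦ by
        simp only [christoffelFirst_eq, metricDeriv_smul_right, metricDeriv_smul_left,
          RingHom.id_apply, smul_eq_mul]; ring }
  change _ = L w
  conv_rhs => rw [← (tangentONB y).sum_repr w]
  simp only [map_sum, map_smul, christoffel, sum_inner, inner_smul_left, L,
    OrthonormalBasis.repr_apply_apply, smul_eq_mul]
  exact Finset.sum_congr rfl fun i _ ↦ by simp [mul_comm]

theorem christoffel_comm (y : N) (u v : TangentSpace J y) :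
    christoffel y u v = christoffel y v u := by
  refine ext_inner_right ℝ fun w ↦ ?_
  simp only [inner_christoffel, christoffelFirst_eq, metricDeriv_comm y w u v]
  ring

theorem christoffel_add_left (y : N) (u u' v : TangentSpace J y) :
    christoffel y (u + u') v = christoffel y u v + christoffel y u' v := by
  refine ext_inner_right ℝ fun w ↦ ?_
  simp only [inner_add_left, inner_christoffel, christoffelFirst_eq, metricDeriv_add_left,
    metricDeriv_add_mid]
  ring

theorem christoffel_smul_left (y : N) (c : ℝ) (u v : TangentSpace J y) :
    christoffel y (c • u) v = c • christoffel y u v := by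
  refine ext_inner_right ℝ fun w ↦ ?_
  simp only [inner_smul_left, inner_christoffel, christoffelFirst_eq, metricDeriv_smul_left,
    metricDeriv_smul_mid]
  simp
  ring

theorem christoffel_add_right (y : N) (u v v' : TangentSpace J y) :
    christoffel y u (v + v') = christoffel y u v + christoffel y u v' := by
  simp only [christoffel_comm y u, christoffel_add_left]

theorem christoffel_smul_right (y : N) (c : ℝ) (u v : TangentSpace J y) :
    christoffel y u (c • v) = c • christoffel y u v := by
  simp only [christoffel_comm y u, christoffel_smul_left]

/-- In the preferred chart at `y`, the Christoffel symbols are compatible with the metric. -/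
theorem metricDeriv_eq (y : N) (u v w : TangentSpace J y) :
    metricDeriv y u v w = ⟪christoffel y u v, w⟫_ℝ + ⟪v, christoffel y u w⟫_ℝ := by
  rw [real_inner_comm _ v, inner_christoffel, inner_christoffel, christoffelFirst_eq,
    christoffelFirst_eq, metricDeriv_comm y u w v]
  ring

end Christoffel

section PullbackCov

variable {E : Type*} [NormedAddCommGroup E] [NormedSpace ℝ E] [FiniteDimensional ℝ E]
  {H : Type*} [TopologicalSpace H] {I : ModelWithCorners ℝ E H}
  {M : Type*} [TopologicalSpace M] [ChartedSpace H M]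
  {F : Type*} [NormedAddCommGroup F] [NormedSpace ℝ F] [FiniteDimensional ℝ F]
  {H' : Type*} [TopologicalSpace H'] {J : ModelWithCorners ℝ F H'}
  {N : Type*} [TopologicalSpace N] [ChartedSpace H' N] [IsManifold J ∞ N]
  [RiemannianBundle (fun y : N ↦ TangentSpace J y)]
  [IsContMDiffRiemannianBundle J ∞ F (fun y : N ↦ TangentSpace J y)]
  {φ : M → N} {x : M} {V W : ∀ p, TangentSpace J (φ p)} {u : TangentSpace I x}

theorem pullbackCov_eq :
    pullbackCov I J φ V x u =
      (trivializationAt F (fun p : N ↦ TangentSpace J p) (φ x)).symm (φ x)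
        (d% (coordAlong φ V x) x u) + christoffel (φ x) (mfderiv I J φ x u) (V x) :=
  rfl

theorem pullbackCov_congr (h : ∀ᶠ p in 𝓝 x, V p = W p) :
    pullbackCov I J φ V x u = pullbackCov I J φ W x u := by
  rw [pullbackCov_eq, pullbackCov_eq, mvfderiv_congr (coordAlong_congr h), h.self_of_nhds]

theorem pullbackCov_add (hV : DiffAlong I φ V x) (hW : DiffAlong I φ W x) :
    pullbackCov I J φ (fun p ↦ V p + W p) x u =
      pullbackCov I J φ V x u + pullbackCov I J φ W x u := by
  simp only [pullbackCov_eq, christoffel_add_right]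
  rw [mvfderiv_congr (coordAlong_add hV.continuousAt),
    mvfderiv_fun_add (diffAlong_iff.1 hV).2 (diffAlong_iff.1 hW).2, add_apply,
    trivialization_symm_add
      (mem_baseSet_trivializationAt F (fun q : N ↦ TangentSpace J q) (φ x))]
  abel

theorem pullbackCov_smul {f : M → ℝ} (hf : MDifferentiableAt I 𝓘(ℝ) f x)
    (hV : DiffAlong I φ V x) :
    pullbackCov I J φ (fun p ↦ f p • V p) x u =
      (d% f x u) • V x + f x • pullbackCov I J φ V x u := by
  simp only [pullbackCov_eq, christoffel_smul_right]
  rw [mvfderiv_congr (coordAlong_smul hV.continuousAt),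
    mvfderiv_fun_smul hf (diffAlong_iff.1 hV).2, add_apply,
    trivialization_symm_add
      (mem_baseSet_trivializationAt F (fun q : N ↦ TangentSpace J q) (φ x))]
  have h : (trivializationAt F (fun p : N ↦ TangentSpace J p) (φ x)).symm (φ x)
      (coordAlong φ V x x) = V x :=
    (trivializationAt F (fun q : N ↦ TangentSpace J q) (φ x)).symm_apply_apply_mk
      (mem_baseSet_trivializationAt F (fun q : N ↦ TangentSpace J q) (φ x)) (V x)
  simp only [smul_apply, ContinuousLinearMap.smulRight_apply,
    trivialization_symm_smul
      (mem_baseSet_trivializationAt F (fun q : N ↦ TangentSpace J q) (φ x)), h]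
  module

theorem pullbackCov_zero (hφ : MDifferentiableAt I J φ x) :
    pullbackCov I J φ (fun p ↦ (0 : TangentSpace J (φ p))) x u = 0 := by
  have := pullbackCov_add (u := u) (diffAlong_zero hφ) (diffAlong_zero (J := J) hφ)
  simpa using this

theorem pullbackCov_sum {ι : Type*} (s : Finset ι) {V : ι → ∀ p, TangentSpace J (φ p)}
    (hφ : MDifferentiableAt I J φ x) (hV : ∀ i ∈ s, DiffAlong I φ (V i) x) :
    pullbackCov I J φ (fun p ↦ ∑ i ∈ s, V i p) x u = ∑ i ∈ s, pullbackCov I J φ (V i) x u := by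
  classical
  induction s using Finset.induction_on with
  | empty => simpa using pullbackCov_zero hφ
  | insert a s ha ih =>
    simp only [Finset.sum_insert ha]
    rw [pullbackCov_add (hV a (by simp)) (.sum s hφ fun i hi ↦ hV i (by simp [hi])),
      ih fun i hi ↦ hV i (by simp [hi])]

variable (I J φ V x) in
/-- The covariant derivative as a linear map in the direction of differentiation. -/
def pullbackCovLin : TangentSpace I x →ₗ[ℝ] TangentSpace J (φ x) where
  toFun := pullbackCov I J φ V x
  map_add' a b := by
    simp only [pullbackCov_eq, map_add, trivialization_symm_add
      (mem_baseSet_trivializationAt F (fun q : N ↦ TangentSpace J q) (φ x)), christoffel_add_left]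
    abel
  map_smul' c a := by
    simp only [pullbackCov_eq, map_smul, trivialization_symm_smul
      (mem_baseSet_trivializationAt F (fun q : N ↦ TangentSpace J q) (φ x)),
      christoffel_smul_left, RingHom.id_apply, smul_add]

theorem leviCivita_eq_pullbackCov (W : ∀ y : N, TangentSpace J y) (y : N) (v : TangentSpace J y) :
    leviCivita W y v = pullbackCov J J (fun q ↦ q) W y v := by
  have h : mfderiv J J (fun q : N ↦ q) y v = v := by
    have := mfderiv_id (I := J) (x := y)
    exact congr($this v)
  change _ + _ = _ + christoffel y (mfderiv J J (fun q : N ↦ q) y v) (W y)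
  rw [h]

theorem pullbackCov_comp_map {W : ∀ y : N, TangentSpace J y} (hφ : MDifferentiableAt I J φ x)
    (hW : DiffField W (φ x)) :
    pullbackCov I J φ (fun p ↦ W (φ p)) x u = leviCivita W (φ x) (mfderiv I J φ x u) := by
  have h : d% (coordAlong φ (fun p ↦ W (φ p)) x) x u =
      d% (coordAlong (fun q ↦ q) W (φ x)) (φ x) (mfderiv I J φ x u) := by
    have := mfderiv_comp (I := I) (I' := J) (I'' := 𝓘(ℝ, F)) x (diffAlong_iff.1 hW).2 hφ
    exact congr($this u)
  rw [pullbackCov_eq, h]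
  rfl

end PullbackCov

section Metric

variable {E : Type*} [NormedAddCommGroup E] [NormedSpace ℝ E] [FiniteDimensional ℝ E]
  {H : Type*} [TopologicalSpace H] {I : ModelWithCorners ℝ E H}
  {M : Type*} [TopologicalSpace M] [ChartedSpace H M]
  {F : Type*} [NormedAddCommGroup F] [NormedSpace ℝ F] [FiniteDimensional ℝ F]
  {H' : Type*} [TopologicalSpace H'] {J : ModelWithCorners ℝ F H'}
  {N : Type*} [TopologicalSpace N] [ChartedSpace H' N] [IsManifold J ∞ N]
  [RiemannianBundle (fun y : N ↦ TangentSpace J y)]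
  [IsContMDiffRiemannianBundle J ∞ F (fun y : N ↦ TangentSpace J y)]
  {φ : M → N} {x : M} {V W : ∀ p, TangentSpace J (φ p)} {u : TangentSpace I x}

theorem DiffAlong.inner (hV : DiffAlong I φ V x) (hW : DiffAlong I φ W x) :
    MDifferentiableAt I 𝓘(ℝ) (fun p ↦ ⟪V p, W p⟫_ℝ) x :=
  MDifferentiableAt.inner_bundle (b := φ) hV hW

theorem SmoothAlong.inner {k : ℕ∞} (hV : SmoothAlong I k φ V x) (hW : SmoothAlong I k φ W x) :
    ContMDiffAt I 𝓘(ℝ) k (fun p ↦ ⟪V p, W p⟫_ℝ) x :=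
  ContMDiffAt.inner_bundle (b := φ) hV hW

theorem leviCivita_extend (y : N) (v w : TangentSpace J y) :
    leviCivita (FiberBundle.extend F w) y v = christoffel y v w := by
  have h : coordAlong (fun q : N ↦ q) (FiberBundle.extend F w) y =ᶠ[𝓝 y] fun _ ↦
      (trivializationAt F (fun q : N ↦ TangentSpace J q) y ⟨y, w⟩).2 := by
    filter_upwards [eventually_mem_baseSet (J := J) (φ := fun q : N ↦ q) continuousAt_id]
      with q hq
    simp only [coordAlong, FiberBundle.extend]
    have := (trivializationAt F (fun q : N ↦ TangentSpace J q) y).apply_mk_symm hq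
      (trivializationAt F (TangentSpace J) y (⟨y, w⟩ : TangentBundle J N)).2
    rw [this]
  have h' := mvfderiv_congr (I := J) h
  rw [mvfderiv_const] at h'
  have h'' := trivialization_symm_smul
    (mem_baseSet_trivializationAt F (fun q : N ↦ TangentSpace J q) y) 0 (0 : F)
  rw [zero_smul, zero_smul] at h''
  change (trivializationAt F (fun p : N ↦ TangentSpace J p) y).symm y
    (d% (coordAlong (fun q : N ↦ q) (FiberBundle.extend F w) y) y v) + christoffel y v _ = _
  rw [h', zero_apply, h'', zero_add, FiberBundle.extend_apply_self]

theorem mvfderiv_inner_sum_left {ι : Type*} (s : Finset ι) {f : ι → M → ℝ}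
    {V : ι → ∀ p, TangentSpace J (φ p)}
    (hφ : MDifferentiableAt I J φ x) (hf : ∀ i, MDifferentiableAt I 𝓘(ℝ) (f i) x)
    (hV : ∀ i, DiffAlong I φ (V i) x) (hW : DiffAlong I φ W x)
    (h : ∀ i, d% (fun p ↦ ⟪V i p, W p⟫_ℝ) x u =
      ⟪pullbackCov I J φ (V i) x u, W x⟫_ℝ + ⟪V i x, pullbackCov I J φ W x u⟫_ℝ) :
    d% (fun p ↦ ⟪∑ i ∈ s, f i p • V i p, W p⟫_ℝ) x u =
      ⟪pullbackCov I J φ (fun p ↦ ∑ i ∈ s, f i p • V i p) x u, W x⟫_ℝ +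
        ⟪∑ i ∈ s, f i x • V i x, pullbackCov I J φ W x u⟫_ℝ := by
  classical
  rw [pullbackCov_sum s hφ fun i _ ↦ (hV i).smul (hf i)]
  induction s using Finset.induction_on with
  | empty => simp [mvfderiv_const]
  | insert a s ha ih =>
    simp only [Finset.sum_insert ha, inner_add_left]
    rw [mvfderiv_fun_add (((hV a).smul (hf a)).inner hW)
      ((DiffAlong.sum s hφ fun i _ ↦ (hV i).smul (hf i)).inner hW), add_apply, ih]
    simp only [inner_smul_left, RCLike.conj_to_real]
    rw [mvfderiv_fun_mul (hf a) ((hV a).inner hW), pullbackCov_smul (hf a) (hV a)]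
    simp only [add_apply, smul_apply, smul_eq_mul, inner_add_left, inner_smul_left, h a,
      RCLike.conj_to_real]
    ring

theorem mvfderiv_inner_extend (hφ : MDifferentiableAt I J φ x) (v w : TangentSpace J (φ x)) :
    d% (fun p ↦ ⟪(FiberBundle.extend F v : ∀ q : N, TangentSpace J q) (φ p),
        FiberBundle.extend F w (φ p)⟫_ℝ) x u =
      ⟪pullbackCov I J φ (fun p ↦ FiberBundle.extend F v (φ p)) x u,
        FiberBundle.extend F w (φ x)⟫_ℝ +
      ⟪FiberBundle.extend F v (φ x),
        pullbackCov I J φ (fun p ↦ FiberBundle.extend F w (φ p)) x u⟫_ℝ := by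
  rw [pullbackCov_comp_map hφ (diffField_extend v), pullbackCov_comp_map hφ (diffField_extend w),
    leviCivita_extend, leviCivita_extend, FiberBundle.extend_apply_self,
    FiberBundle.extend_apply_self, ← metricDeriv_eq]
  have := mfderiv_comp (I := I) (I' := J) (I'' := 𝓘(ℝ, ℝ)) x
    ((diffField_extend v).inner (diffField_extend w)) hφ
  exact congr($this u)

theorem mvfderiv_inner_of_extend (hV : DiffAlong I φ V x) (hW : DiffAlong I φ W x)
    (h : ∀ v : TangentSpace J (φ x),
      d% (fun p ↦ ⟪(FiberBundle.extend F v : ∀ q : N, TangentSpace J q) (φ p), W p⟫_ℝ) x u =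
        ⟪pullbackCov I J φ (fun p ↦ FiberBundle.extend F v (φ p)) x u, W x⟫_ℝ +
          ⟪FiberBundle.extend F v (φ x), pullbackCov I J φ W x u⟫_ℝ) :
    d% (fun p ↦ ⟪V p, W p⟫_ℝ) x u =
      ⟪pullbackCov I J φ V x u, W x⟫_ℝ + ⟪V x, pullbackCov I J φ W x u⟫_ℝ := by
  have hφ := (diffAlong_iff.1 hV).1
  have hexp := eventually_eq_sum_chartCoeff hφ.continuousAt V
  have h1 : (fun p ↦ ⟪V p, W p⟫_ℝ) =ᶠ[𝓝 x] fun p ↦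
      ⟪∑ i, chartCoeff φ V x i p • FiberBundle.extend F (chartVec J (φ x) i) (φ p), W p⟫_ℝ :=
    hexp.mono fun p hp ↦ congrArg (fun v ↦ ⟪v, W p⟫_ℝ) hp
  rw [mvfderiv_congr h1, pullbackCov_congr hexp]
  conv_rhs => enter [2, 2]; rw [hexp.self_of_nhds]
  exact mvfderiv_inner_sum_left Finset.univ hφ hV.chartCoeff
    (fun i ↦ (diffField_extend (chartVec J (φ x) i)).comp_map hφ) hW fun i ↦ h _

/-- The connection on `φ⁻¹TN` is compatible with the metric. -/
theorem mvfderiv_inner (hV : DiffAlong I φ V x) (hW : DiffAlong I φ W x) :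
    d% (fun p ↦ ⟪V p, W p⟫_ℝ) x u =
      ⟪pullbackCov I J φ V x u, W x⟫_ℝ + ⟪V x, pullbackCov I J φ W x u⟫_ℝ := by
  have hφ := (diffAlong_iff.1 hV).1
  refine mvfderiv_inner_of_extend hV hW fun v ↦ ?_
  have h := mvfderiv_inner_of_extend (u := u) hW ((diffField_extend v).comp_map hφ)
    fun w ↦ mvfderiv_inner_extend hφ w v
  simp only [real_inner_comm] at h ⊢
  rw [h, add_comm]

end Metric

section Bracket

open VectorField

variable {E : Type*} [NormedAddCommGroup E] [NormedSpace ℝ E] [FiniteDimensional ℝ E]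
  {H : Type*} [TopologicalSpace H] {I : ModelWithCorners ℝ E H}
  {M : Type*} [TopologicalSpace M] [ChartedSpace H M] [IsManifold I ∞ M]
  {F : Type*} [NormedAddCommGroup F] [NormedSpace ℝ F]
  {H' : Type*} [TopologicalSpace H'] {J : ModelWithCorners ℝ F H'}
  {N : Type*} [TopologicalSpace N] [ChartedSpace H' N] [IsManifold J ∞ N]
  {x : M} {X Y : ∀ p : M, TangentSpace I p}

theorem SmoothAlong.mfderivAt {φ : M → N} {k l : ℕ∞ω} (hφ : ContMDiffAt I J k φ x)
    (hX : SmoothField l X x) (h : l + 1 ≤ k) :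
    SmoothAlong I l φ (fun p ↦ _root_.mfderiv I J φ p (X p)) x :=
  ContMDiffAt.clm_apply_of_inCoordinates (b₁ := fun p : M ↦ p) (b₂ := φ)
    (ϕ := fun p ↦ _root_.mfderiv I J φ p) (v := X)
    (hφ.mfderiv_const h) hX (hφ.of_le (le_self_add.trans h))

theorem SmoothAlong.mvfderiv {f : M → F} {k l : ℕ∞ω} (hf : ContMDiffAt I 𝓘(ℝ, F) k f x)
    (hX : SmoothField l X x) (h : l + 1 ≤ k) :
    ContMDiffAt I 𝓘(ℝ, F) l (fun p ↦ d% f p (X p)) x := by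
  have h1 := (smoothAlong_iff.1 (SmoothAlong.mfderivAt hf hX h)).2
  refine h1.congr_of_eventuallyEq (.of_forall fun p ↦ ?_)
  simp [coordAlong]
  rfl

theorem mlieBracket_mlieBracket_smul {f : M → ℝ} {W : ∀ p : M, TangentSpace I p}
    (hY : SmoothField 2 Y x) (hf : ContMDiffAt I 𝓘(ℝ) 2 f x) (hW : SmoothField 2 W x) :
    mlieBracket I X (mlieBracket I Y (f • W)) x =
      d% (fun p ↦ d% f p (Y p)) x (X x) • W x + d% f x (Y x) • mlieBracket I X W x +
      (d% f x (X x) • mlieBracket I Y W x + f x • mlieBracket I X (mlieBracket I Y W) x) := by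
  have h1 : mlieBracket I Y (f • W) =ᶠ[𝓝 x]
      (fun p ↦ d% f p (Y p)) • W + f • mlieBracket I Y W := by
    filter_upwards [(contMDiffAt_iff_contMDiffAt_nhds (by simp)).1 hf,
      (contMDiffAt_iff_contMDiffAt_nhds (by simp)).1 hW] with p hfp hWp
    exact mlieBracket_smul_right (hfp.mdifferentiableAt (by simp)) (hWp.mdifferentiableAt (by simp))
  have hYf : MDifferentiableAt I 𝓘(ℝ) (fun p ↦ d% f p (Y p)) x :=
    (SmoothAlong.mvfderiv (k := 2) (l := 1) hf (hY.of_le (by norm_cast)) (by norm_cast)).mdifferentiableAt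
      (by simp)
  have hW' : MDifferentiableAt I I.tangent (fun p ↦ (⟨p, W p⟩ : TangentBundle I M)) x :=
    ContMDiffAt.mdifferentiableAt hW (by simp)
  have hf' : MDifferentiableAt I 𝓘(ℝ) f x := hf.mdifferentiableAt (by simp)
  have hYW : MDifferentiableAt I I.tangent
      (fun p ↦ (⟨p, mlieBracket I Y W p⟩ : TangentBundle I M)) x := by
    have : IsManifold I (minSmoothness ℝ 2) M := by simp; infer_instance
    have : IsManifold I ((2 : ℕ∞) + 1) M := inferInstanceAs (IsManifold I ((3 : ℕ) : ℕ∞ω) M)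
    exact (ContMDiffAt.mlieBracket_vectorField (m := 1) (n := 2) hY hW
      (by simp; norm_cast)).mdifferentiableAt (by simp)
  refine (Filter.EventuallyEq.mlieBracket_vectorField_eq (V₁ := X) .rfl h1).trans ?_
  rw [mlieBracket_add_right (hYf.smul_section hW') (hf'.smul_section hYW),
    mlieBracket_smul_right hYf hW', mlieBracket_smul_right hf' hYW]

/-- `X(Yf) - Y(Xf) = [X, Y]f`. -/
theorem mlieBracket_apply_scalar {f : M → ℝ} (hX : SmoothField 2 X x) (hY : SmoothField 2 Y x)
    (hf : ContMDiffAt I 𝓘(ℝ) 2 f x) :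
    d% (fun p ↦ d% f p (Y p)) x (X x) - d% (fun p ↦ d% f p (X p)) x (Y x) =
      d% f x (mlieBracket I X Y x) := by
  have : IsManifold I (minSmoothness ℝ 3) M := by simp; infer_instance
  have key (W : ∀ p : M, TangentSpace I p) (hW : SmoothField 2 W x) :
      (d% (fun p ↦ d% f p (Y p)) x (X x) - d% (fun p ↦ d% f p (X p)) x (Y x) -
      d% f x (mlieBracket I X Y x)) • W x = 0 := by
    have hW' : MDifferentiableAt I I.tangent (fun p ↦ (⟨p, W p⟩ : TangentBundle I M)) x :=
      ContMDiffAt.mdifferentiableAt hW (by simp)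
    have h1 := leibniz_identity_mlieBracket_apply (U := X) (V := Y) (W := f • W) (x := x)
      (by simpa using! hX) (by simpa using! hY)
      (by simpa using! SmoothAlong.smul hf hW)
    have h2 := leibniz_identity_mlieBracket_apply (U := X) (V := Y) (W := W) (x := x)
      (by simpa using! hX) (by simpa using! hY) (by simpa using! hW)
    rw [mlieBracket_mlieBracket_smul hY hf hW, mlieBracket_mlieBracket_smul hX hf hW,
      mlieBracket_smul_right (hf.mdifferentiableAt (by simp)) hW', h2] at h1
    rw [← sub_eq_zero] at h1
    rw [← h1]
    module
  by_cases h : X x = 0 ∧ Y x = 0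
  · rw [mlieBracket, mlieBracketWithin_eq_zero_of_eq_zero h.1 h.2, h.1, h.2]
    simp
  · obtain ⟨W, hW, hW0⟩ : ∃ W : ∀ p : M, TangentSpace I p, SmoothField 2 W x ∧ W x ≠ 0 := by
      by_cases hx : X x = 0
      · exact ⟨Y, hY, fun hy ↦ h ⟨hx, hy⟩⟩
      · exact ⟨X, hX, hx⟩
    exact sub_eq_zero.1 ((smul_eq_zero.1 (key W hW)).resolve_right hW0)

end Bracket

section BracketVector

open VectorField

variable {E : Type*} [NormedAddCommGroup E] [NormedSpace ℝ E] [FiniteDimensional ℝ E]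
  {H : Type*} [TopologicalSpace H] {I : ModelWithCorners ℝ E H}
  {M : Type*} [TopologicalSpace M] [ChartedSpace H M] [IsManifold I ∞ M]
  {F : Type*} [NormedAddCommGroup F] [NormedSpace ℝ F] [FiniteDimensional ℝ F]
  {x : M} {X Y : ∀ p : M, TangentSpace I p}

theorem mvfderiv_clm_comp {f : M → F} (hf : MDifferentiableAt I 𝓘(ℝ, F) f x) (l : F →L[ℝ] ℝ)
    (u : TangentSpace I x) : d% (fun p ↦ l (f p)) x u = l (d% f x u) := by
  have := mfderiv_comp (I := I) (I' := 𝓘(ℝ, F)) (I'' := 𝓘(ℝ, ℝ)) x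
    l.mdifferentiableAt hf
  rw [l.mfderiv_eq] at this
  exact congr($this u)

/-- `X(Yf) - Y(Xf) = [X, Y]f` for vector-valued functions. -/
theorem mlieBracket_apply {f : M → F} (hX : SmoothField 2 X x) (hY : SmoothField 2 Y x)
    (hf : ContMDiffAt I 𝓘(ℝ, F) 2 f x) :
    d% (fun p ↦ d% f p (Y p)) x (X x) - d% (fun p ↦ d% f p (X p)) x (Y x) =
      d% f x (mlieBracket I X Y x) := by
  refine (Module.finBasis ℝ F).ext_elem fun i ↦ ?_
  let l : F →L[ℝ] ℝ := LinearMap.toContinuousLinearMap ((Module.finBasis ℝ F).coord i)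
  change l _ = l _
  have hl : ContMDiffAt I 𝓘(ℝ) 2 (fun p ↦ l (f p)) x :=
    l.contMDiff.contMDiffAt.comp x hf
  have hev : ∀ᶠ p in 𝓝 x, ContMDiffAt I 𝓘(ℝ, F) 2 f p :=
    (contMDiffAt_iff_contMDiffAt_nhds (by simp)).1 hf
  have hd {Z : ∀ p : M, TangentSpace I p} (hZ : SmoothField 2 Z x) :
      MDifferentiableAt I 𝓘(ℝ, F) (fun p ↦ d% f p (Z p)) x :=
    (SmoothAlong.mvfderiv (k := 2) (l := 1) hf (hZ.of_le (by norm_cast))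
      (by norm_cast)).mdifferentiableAt (by simp)
  have hc {Z : ∀ p : M, TangentSpace I p} : (fun p ↦ d% (fun p ↦ l (f p)) p (Z p)) =ᶠ[𝓝 x]
      fun p ↦ l (d% f p (Z p)) :=
    hev.mono fun p hp ↦ mvfderiv_clm_comp (hp.mdifferentiableAt (by simp)) l _
  have h := mlieBracket_apply_scalar hX hY hl
  rwa [mvfderiv_congr hc, mvfderiv_congr hc, mvfderiv_clm_comp (hd hX), mvfderiv_clm_comp (hd hY),
    mvfderiv_clm_comp (hf.mdifferentiableAt (by simp)), ← map_sub] at h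

end BracketVector

section Torsion

open VectorField

variable {E : Type*} [NormedAddCommGroup E] [NormedSpace ℝ E] [FiniteDimensional ℝ E]
  {H : Type*} [TopologicalSpace H] {I : ModelWithCorners ℝ E H}
  {M : Type*} [TopologicalSpace M] [ChartedSpace H M] [IsManifold I ∞ M]
  {F : Type*} [NormedAddCommGroup F] [NormedSpace ℝ F] [FiniteDimensional ℝ F]
  {H' : Type*} [TopologicalSpace H'] {J : ModelWithCorners ℝ F H'}
  {N : Type*} [TopologicalSpace N] [ChartedSpace H' N] [IsManifold J ∞ N]
  [RiemannianBundle (fun y : N ↦ TangentSpace J y)]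
  [IsContMDiffRiemannianBundle J ∞ F (fun y : N ↦ TangentSpace J y)]
  {φ : M → N} {x : M} {X Y : ∀ p : M, TangentSpace I p}

theorem coordAlong_mfderiv (hφ : ContMDiff I J ∞ φ) (X : ∀ p : M, TangentSpace I p) :
    coordAlong φ (fun p ↦ mfderiv I J φ p (X p)) x =ᶠ[𝓝 x]
      fun p ↦ d% (fun p ↦ extChartAt J (φ x) (φ p)) p (X p) := by
  filter_upwards [hφ.continuous.continuousAt.eventually
    ((chartAt H' (φ x)).open_source.mem_nhds (mem_chart_source H' (φ x)))] with p hp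
  have h1 := mfderiv_comp (I := I) (I' := J) (I'' := 𝓘(ℝ, F)) p
    (mdifferentiableAt_extChartAt (I := J) hp) (hφ.mdifferentiable (by simp) p)
  have h2 := TangentBundle.continuousLinearMapAt_trivializationAt (I := J) hp
  rw [← h2] at h1
  have h3 := congr($h1 (X p))
  refine Eq.trans ?_ h3.symm
  have hb : φ p ∈ (trivializationAt F (fun q : N ↦ TangentSpace J q) (φ x)).baseSet := hp
  exact (congrFun ((trivializationAt F (fun q : N ↦ TangentSpace J q) (φ x)).coe_linearMapAt_of_mem
    (R := ℝ) hb) (mfderiv I J φ p (X p))).symm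

/-- The connection on `φ⁻¹TN` is torsion-free: `∇_X dφ(Y) - ∇_Y dφ(X) = dφ[X, Y]`. -/
theorem pullbackCov_mfderiv_sub (hφ : ContMDiff I J ∞ φ) (hX : SmoothField 2 X x)
    (hY : SmoothField 2 Y x) :
    pullbackCov I J φ (fun p ↦ mfderiv I J φ p (Y p)) x (X x) -
      pullbackCov I J φ (fun p ↦ mfderiv I J φ p (X p)) x (Y x) =
      mfderiv I J φ x (mlieBracket I X Y x) := by
  have hg : ContMDiffAt I 𝓘(ℝ, F) 2 (fun p ↦ extChartAt J (φ x) (φ p)) x :=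
    (contMDiffAt_extChartAt (n := 2)).comp x ((hφ x).of_le (by norm_cast))
  have h := mlieBracket_apply hX hY hg
  have hb := mem_baseSet_trivializationAt F (fun q : N ↦ TangentSpace J q) (φ x)
  rw [pullbackCov_eq, pullbackCov_eq, christoffel_comm (φ x) _ (mfderiv I J φ x (X x)),
    add_sub_add_right_eq_sub, mvfderiv_congr (coordAlong_mfderiv hφ Y),
    mvfderiv_congr (coordAlong_mfderiv hφ X)]
  rw [sub_eq_iff_eq_add] at h
  have h' : coordAlong φ _ x x = d% (fun p ↦ extChartAt J (φ x) (φ p)) x (mlieBracket I X Y x) :=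
    (coordAlong_mfderiv hφ (mlieBracket I X Y)).self_of_nhds
  rw [h, trivialization_symm_add hb, add_sub_cancel_right, ← h']
  exact (trivializationAt F (fun q : N ↦ TangentSpace J q) (φ x)).symm_apply_apply_mk hb _

end Torsion

section LeviCivita

open VectorField

variable {F : Type*} [NormedAddCommGroup F] [NormedSpace ℝ F] [FiniteDimensional ℝ F]
  {H' : Type*} [TopologicalSpace H'] {J : ModelWithCorners ℝ F H'}
  {N : Type*} [TopologicalSpace N] [ChartedSpace H' N] [IsManifold J ∞ N]
  [RiemannianBundle (fun y : N ↦ TangentSpace J y)]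
  [IsContMDiffRiemannianBundle J ∞ F (fun y : N ↦ TangentSpace J y)]
  {y : N} {U V W : ∀ q : N, TangentSpace J q}

theorem mfderiv_fun_id_apply (y : N) (v : TangentSpace J y) :
    mfderiv J J (fun q : N ↦ q) y v = v := by
  have := mfderiv_id (I := J) (x := y)
  exact congr($this v)

theorem leviCivita_sub (hU : SmoothField 2 U y) (hV : SmoothField 2 V y) :
    leviCivita V y (U y) - leviCivita U y (V y) = mlieBracket J U V y := by
  have := pullbackCov_mfderiv_sub (φ := fun q : N ↦ q) (J := J) contMDiff_id hU hV
  simp only [mfderiv_fun_id_apply] at this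
  simpa only [leviCivita_eq_pullbackCov]

theorem mvfderiv_inner_field {u : TangentSpace J y} (hV : DiffField V y) (hW : DiffField W y) :
    d% (fun q ↦ ⟪V q, W q⟫_ℝ) y u = ⟪leviCivita V y u, W y⟫_ℝ + ⟪V y, leviCivita W y u⟫_ℝ := by
  simpa only [leviCivita_eq_pullbackCov] using mvfderiv_inner hV hW

/-- The Koszul formula. -/
theorem koszul (hU : SmoothField 2 U y) (hV : SmoothField 2 V y) (hW : SmoothField 2 W y) :
    2 * ⟪leviCivita V y (U y), W y⟫_ℝ =
      d% (fun q ↦ ⟪V q, W q⟫_ℝ) y (U y) + d% (fun q ↦ ⟪U q, W q⟫_ℝ) y (V y)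
        - d% (fun q ↦ ⟪U q, V q⟫_ℝ) y (W y) + ⟪mlieBracket J U V y, W y⟫_ℝ
        - ⟪mlieBracket J U W y, V y⟫_ℝ - ⟪mlieBracket J V W y, U y⟫_ℝ := by
  have hU' := hU.diffAlong (by simp)
  have hV' := hV.diffAlong (by simp)
  have hW' := hW.diffAlong (by simp)
  rw [← leviCivita_sub hU hV, ← leviCivita_sub hU hW, ← leviCivita_sub hV hW,
    mvfderiv_inner_field hV' hW', mvfderiv_inner_field hU' hW', mvfderiv_inner_field hU' hV']
  simp only [inner_sub_left]
  rw [real_inner_comm (leviCivita W y (U y)) (V y), real_inner_comm (leviCivita W y (V y)) (U y),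
    real_inner_comm (leviCivita V y (W y)) (U y)]
  ring

/-- Every orthonormal basis of a tangent space extends to a smooth local orthonormal frame. -/
theorem exists_orthonormal_frame {k : ℕ} (b : Fin k → TangentSpace J y) (hb : Orthonormal ℝ b) :
    ∃ e : Fin k → ∀ q : N, TangentSpace J q, (∀ i, SmoothField ∞ (e i) y) ∧ (∀ i, e i y = b i) ∧
      ∀ᶠ q in 𝓝 y, Orthonormal ℝ fun i ↦ e i q := by
  let s (q : N) (i : Fin k) : TangentSpace J q := FiberBundle.extend F (b i) q
  have hsy : s y = b := funext fun i ↦ FiberBundle.extend_apply_self F (b i)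
  let g (i : Fin k) (q : N) : TangentSpace J q := InnerProductSpace.gramSchmidt ℝ (s q) i
  have hgy (i) : g i y = b i := by
    change InnerProductSpace.gramSchmidt ℝ (s y) i = b i
    rw [hsy, InnerProductSpace.gramSchmidt_of_orthogonal ℝ fun i j hij ↦ hb.2 hij]
  have hgsq (i) : ⟪g i y, g i y⟫_ℝ = 1 := by
    simp [hgy, hb.1 i]
  have hg (i) : SmoothField ∞ (g i) y := by
    induction i using WellFoundedLT.induction with
    | ind i ih =>
      have h : g i = fun q ↦ s q i - ∑ j ∈ Finset.Iio i,
          (⟪g j q, s q i⟫_ℝ * (⟪g j q, g j q⟫_ℝ)⁻¹) • g j q := by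
        funext q
        simp only [g]
        rw [InnerProductSpace.gramSchmidt_def]
        simp only [Submodule.starProjection_singleton, real_inner_self_eq_norm_sq, div_eq_mul_inv]
        rfl
      rw [h]
      refine (smoothAlong_extend (b i)).sub (.sum _ contMDiffAt_id fun j hj ↦ ?_)
      have hj := ih j (Finset.mem_Iio.1 hj)
      refine SmoothAlong.smul ((SmoothAlong.inner hj (smoothAlong_extend (b i))).mul ?_) hj
      exact (SmoothAlong.inner hj hj).inv₀ (by rw [hgsq]; exact one_ne_zero)
  refine ⟨fun i q ↦ (Real.sqrt ⟪g i q, g i q⟫_ℝ)⁻¹ • g i q, fun i ↦ ?_, fun i ↦ ?_, ?_⟩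
  · refine SmoothAlong.smul (ContMDiffAt.inv₀ ?_ ?_) (hg i)
    · exact (Real.contDiffAt_sqrt (by rw [hgsq]; exact one_ne_zero)).contMDiffAt.comp y
        (SmoothAlong.inner (hg i) (hg i))
    · rw [hgsq, Real.sqrt_one]
      exact one_ne_zero
  · change (Real.sqrt ⟪g i y, g i y⟫_ℝ)⁻¹ • g i y = b i
    rw [hgsq, hgy]
    simp
  · have hne (i) : ∀ᶠ q in 𝓝 y, ⟪g i q, g i q⟫_ℝ ≠ 0 :=
      (SmoothAlong.inner (k := ⊤) (hg i) (hg i)).continuousAt.eventually_ne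
        (by rw [hgsq]; exact one_ne_zero)
    filter_upwards [Filter.eventually_all.2 hne] with q hq
    refine ⟨fun i ↦ ?_, fun i j hij ↦ ?_⟩
    · have h0 : g i q ≠ 0 := fun h ↦ hq i (by simp [h])
      rw [norm_smul, real_inner_self_eq_norm_sq, Real.sqrt_sq (norm_nonneg _), norm_inv, norm_norm,
        inv_mul_cancel₀ (norm_ne_zero_iff.2 h0)]
    · simp only [inner_smul_left, inner_smul_right]
      rw [InnerProductSpace.gramSchmidt_orthogonal ℝ (s q) hij]
      simp

theorem sum_inner_smul_of_orthonormal {k : ℕ} {e : Fin k → TangentSpace J y}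
    (he : Orthonormal ℝ e) (hk : k = Module.finrank ℝ F) (v : TangentSpace J y) :
    ∑ i, ⟪e i, v⟫_ℝ • e i = v := by
  have hs := he.linearIndependent.span_eq_top_of_card_eq_finrank' (by rw [Fintype.card_fin, hk]; rfl)
  simpa using (OrthonormalBasis.mk he hs.ge).sum_repr' v

theorem smoothField_mlieBracket (hU : SmoothField ∞ U y) (hV : SmoothField ∞ V y) :
    SmoothField ∞ (VectorField.mlieBracket J U V) y := by
  have : IsManifold J (minSmoothness ℝ 2) N := by simp; infer_instance
  have : IsManifold J (((⊤ : ℕ∞) : ℕ∞ω) + 1) N := inferInstanceAs (IsManifold J ∞ N)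
  exact ContMDiffAt.mlieBracket_vectorField (m := ⊤) (n := ⊤) hU hV (by simp)

/-- The Levi-Civita derivative of a smooth field in the direction of a smooth field is smooth. -/
theorem SmoothAlong.leviCivita (hW : SmoothField ∞ W y) (hU : SmoothField ∞ U y) :
    SmoothField ∞ (fun q ↦ RiemannianImmersion.leviCivita W q (U q)) y := by
  let k := Module.finrank ℝ F
  let b : OrthonormalBasis (Fin k) ℝ (TangentSpace J y) := tangentONB y
  obtain ⟨e, he, -, hon⟩ := exists_orthonormal_frame b b.orthonormal
  have hd {f : N → ℝ} {X : ∀ q : N, TangentSpace J q} (hf : ContMDiffAt J 𝓘(ℝ) ∞ f y)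
      (hX : SmoothField ∞ X y) : ContMDiffAt J 𝓘(ℝ) ∞ (fun q ↦ d% f q (X q)) y :=
    SmoothAlong.mvfderiv hf hX (by simp)
  have hin {X Y : ∀ q : N, TangentSpace J q} (hX : SmoothField ∞ X y) (hY : SmoothField ∞ Y y) :
      ContMDiffAt J 𝓘(ℝ) ∞ (fun q ↦ ⟪X q, Y q⟫_ℝ) y := SmoothAlong.inner hX hY
  let c (i : Fin k) (q : N) : ℝ := (1 / 2) *
    (d% (fun q ↦ ⟪W q, e i q⟫_ℝ) q (U q) + d% (fun q ↦ ⟪U q, e i q⟫_ℝ) q (W q)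
        - d% (fun q ↦ ⟪U q, W q⟫_ℝ) q (e i q) + ⟪mlieBracket J U W q, e i q⟫_ℝ
        - ⟪mlieBracket J U (e i) q, W q⟫_ℝ - ⟪mlieBracket J W (e i) q, U q⟫_ℝ)
  have hc (i) : ContMDiffAt J 𝓘(ℝ) ∞ (c i) y :=
    contMDiffAt_const.mul ((((((hd (hin hW (he i)) hU).add (hd (hin hU (he i)) hW)).sub
      (hd (hin hU hW) (he i))).add (hin (smoothField_mlieBracket hU hW) (he i))).sub
      (hin (smoothField_mlieBracket hU (he i)) hW)).sub (hin (smoothField_mlieBracket hW (he i)) hU))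
  refine (SmoothAlong.sum Finset.univ contMDiffAt_id fun i _ ↦ (he i).smul (hc i)).congr ?_
  filter_upwards [hon, hU.eventually 2, hW.eventually 2,
    Filter.eventually_all.2 fun i ↦ (he i).eventually 2] with q hq hUq hWq heq
  refine (sum_inner_smul_of_orthonormal hq rfl _).symm.trans (Finset.sum_congr rfl fun i _ ↦ ?_)
  rw [real_inner_comm]
  congr 1
  have := koszul hUq hWq (heq i)
  simp only [c]
  rw [← this]
  ring

end LeviCivita

section LeviCivitaRules

open VectorField

variable {F : Type*} [NormedAddCommGroup F] [NormedSpace ℝ F] [FiniteDimensional ℝ F]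
  {H' : Type*} [TopologicalSpace H'] {J : ModelWithCorners ℝ F H'}
  {N : Type*} [TopologicalSpace N] [ChartedSpace H' N] [IsManifold J ∞ N]
  [RiemannianBundle (fun y : N ↦ TangentSpace J y)]
  [IsContMDiffRiemannianBundle J ∞ F (fun y : N ↦ TangentSpace J y)]
  {y : N} {V W : ∀ q : N, TangentSpace J q} {u : TangentSpace J y}

theorem leviCivita_congr (h : ∀ᶠ q in 𝓝 y, V q = W q) :
    leviCivita V y u = leviCivita W y u := by
  simpa only [leviCivita_eq_pullbackCov] using pullbackCov_congr (φ := fun q : N ↦ q) h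

theorem leviCivita_add (hV : DiffField V y) (hW : DiffField W y) :
    leviCivita (fun q ↦ V q + W q) y u = leviCivita V y u + leviCivita W y u := by
  simpa only [leviCivita_eq_pullbackCov] using pullbackCov_add (φ := fun q : N ↦ q) hV hW

theorem leviCivita_smul {f : N → ℝ} (hf : MDifferentiableAt J 𝓘(ℝ) f y) (hV : DiffField V y) :
    leviCivita (fun q ↦ f q • V q) y u = (d% f y u) • V y + f y • leviCivita V y u := by
  simpa only [leviCivita_eq_pullbackCov] using pullbackCov_smul (φ := fun q : N ↦ q) hf hV

theorem leviCivita_const_smul (c : ℝ) (hV : DiffField V y) :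
    leviCivita (fun q ↦ c • V q) y u = c • leviCivita V y u := by
  have := leviCivita_smul (f := fun _ ↦ c) (u := u) mdifferentiableAt_const hV
  simpa [mvfderiv_const] using this

variable (V y) in
/-- The Levi-Civita derivative as a linear map in the direction of differentiation. -/
def leviCivitaLin : TangentSpace J y →ₗ[ℝ] TangentSpace J y where
  toFun := leviCivita V y
  map_add' a b := by
    simp only [leviCivita_eq_pullbackCov]
    exact (pullbackCovLin J J (fun q ↦ q) y V).map_add a b
  map_smul' c a := by
    simp only [leviCivita_eq_pullbackCov]
    exact (pullbackCovLin J J (fun q ↦ q) y V).map_smul c a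

theorem leviCivita_dir_add (v w : TangentSpace J y) :
    leviCivita V y (v + w) = leviCivita V y v + leviCivita V y w :=
  (leviCivitaLin y V).map_add v w

theorem leviCivita_dir_sub (v w : TangentSpace J y) :
    leviCivita V y (v - w) = leviCivita V y v - leviCivita V y w :=
  (leviCivitaLin y V).map_sub v w

theorem leviCivita_dir_smul (c : ℝ) (v : TangentSpace J y) :
    leviCivita V y (c • v) = c • leviCivita V y v :=
  (leviCivitaLin y V).map_smul c v

theorem leviCivita_dir_sum {ι : Type*} [Fintype ι] (v : ι → TangentSpace J y) :
    leviCivita V y (∑ i, v i) = ∑ i, leviCivita V y (v i) :=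
  map_sum (leviCivitaLin y V) v _

/-- The second covariant derivative `∇_u ∇_v W - ∇_{∇_u v} W` of a vector field. -/
def secondDeriv (W : ∀ q : N, TangentSpace J q) (y : N) (u v : TangentSpace J y) :
    TangentSpace J y :=
  leviCivita (fun q ↦ leviCivita W q (FiberBundle.extend F v q)) y u
    - leviCivita W y (leviCivita (FiberBundle.extend F v) y u)

theorem diffField_leviCivita_extend (hW : SmoothField ∞ W y) (v : TangentSpace J y) :
    DiffField (fun q ↦ leviCivita W q (FiberBundle.extend F v q)) y :=
  (hW.leviCivita (smoothAlong_extend v)).diffAlong (by simp)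

theorem secondDeriv_add_right (hW : SmoothField ∞ W y) (u v v' : TangentSpace J y) :
    secondDeriv W y u (v + v') = secondDeriv W y u v + secondDeriv W y u v' := by
  simp only [secondDeriv, leviCivita_extend, christoffel_add_right, leviCivita_dir_add]
  rw [leviCivita_congr ((extend_add v v').mono fun q hq ↦ by rw [hq, leviCivita_dir_add]),
    leviCivita_add (diffField_leviCivita_extend hW v) (diffField_leviCivita_extend hW v')]
  abel

theorem secondDeriv_smul_right (hW : SmoothField ∞ W y) (c : ℝ) (u v : TangentSpace J y) :
    secondDeriv W y u (c • v) = c • secondDeriv W y u v := by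
  simp only [secondDeriv, leviCivita_extend, christoffel_smul_right, leviCivita_dir_smul]
  rw [leviCivita_congr ((extend_smul c v).mono fun q hq ↦ by rw [hq, leviCivita_dir_smul]),
    leviCivita_const_smul c (diffField_leviCivita_extend hW v), smul_sub]

theorem secondDeriv_add_left (u u' v : TangentSpace J y) :
    secondDeriv W y (u + u') v = secondDeriv W y u v + secondDeriv W y u' v := by
  simp only [secondDeriv, leviCivita_dir_add]
  abel

theorem secondDeriv_smul_left (c : ℝ) (u v : TangentSpace J y) :
    secondDeriv W y (c • u) v = c • secondDeriv W y u v := by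
  simp only [secondDeriv, leviCivita_dir_smul, smul_sub]

theorem secondDeriv_congr (h : ∀ᶠ q in 𝓝 y, V q = W q) (u v : TangentSpace J y) :
    secondDeriv V y u v = secondDeriv W y u v := by
  simp only [secondDeriv]
  rw [leviCivita_congr h, leviCivita_congr (V := fun q ↦ leviCivita V q _)]
  filter_upwards [h.eventually_nhds] with q hq
  exact leviCivita_congr hq

theorem secondDeriv_add (hV : SmoothField ∞ V y) (hW : SmoothField ∞ W y)
    (u v : TangentSpace J y) :
    secondDeriv (fun q ↦ V q + W q) y u v = secondDeriv V y u v + secondDeriv W y u v := by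
  simp only [secondDeriv]
  rw [leviCivita_add (hV.diffAlong (by simp)) (hW.diffAlong (by simp)),
    leviCivita_congr (V := fun q ↦ leviCivita (fun q ↦ V q + W q) q _)
      (W := fun q ↦ leviCivita V q (FiberBundle.extend F v q) +
        leviCivita W q (FiberBundle.extend F v q)),
    leviCivita_add (diffField_leviCivita_extend hV v) (diffField_leviCivita_extend hW v)]
  · abel
  · filter_upwards [hV.eventually 1, hW.eventually 1] with q hVq hWq
    exact leviCivita_add (hVq.diffAlong (by simp)) (hWq.diffAlong (by simp))

theorem secondDeriv_smul (c : ℝ) (hV : SmoothField ∞ V y) (u v : TangentSpace J y) :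
    secondDeriv (fun q ↦ c • V q) y u v = c • secondDeriv V y u v := by
  simp only [secondDeriv]
  rw [leviCivita_const_smul c (hV.diffAlong (by simp)),
    leviCivita_congr (V := fun q ↦ leviCivita (fun q ↦ c • V q) q _)
      (W := fun q ↦ c • leviCivita V q (FiberBundle.extend F v q)),
    leviCivita_const_smul c (diffField_leviCivita_extend hV v), smul_sub]
  filter_upwards [hV.eventually 1] with q hVq
  exact leviCivita_const_smul c (hVq.diffAlong (by simp))

theorem curvature_eq_secondDeriv (u v w : TangentSpace J y) :
    curvature y u v w = secondDeriv (FiberBundle.extend F w) y u v -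
      secondDeriv (FiberBundle.extend F w) y v u := by
  simp only [curvature, curvatureField, secondDeriv]
  rw [← leviCivita_sub ((smoothAlong_extend u).of_le (by norm_cast))
    ((smoothAlong_extend v).of_le (by norm_cast)), leviCivita_dir_sub]
  simp only [FiberBundle.extend_apply_self]
  abel

theorem curvature_swap (u v w : TangentSpace J y) : curvature y u v w = - curvature y v u w := by
  rw [curvature_eq_secondDeriv, curvature_eq_secondDeriv, neg_sub]

theorem curvature_add_left (u u' v w : TangentSpace J y) :
    curvature y (u + u') v w = curvature y u v w + curvature y u' v w := by
  simp only [curvature_eq_secondDeriv, secondDeriv_add_left,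
    secondDeriv_add_right (smoothAlong_extend w)]
  abel

theorem curvature_smul_left (c : ℝ) (u v w : TangentSpace J y) :
    curvature y (c • u) v w = c • curvature y u v w := by
  simp only [curvature_eq_secondDeriv, secondDeriv_smul_left,
    secondDeriv_smul_right (smoothAlong_extend w), smul_sub]

theorem curvature_add_mid (u v v' w : TangentSpace J y) :
    curvature y u (v + v') w = curvature y u v w + curvature y u v' w := by
  rw [curvature_swap, curvature_add_left, curvature_swap v, curvature_swap v']
  abel

theorem curvature_smul_mid (c : ℝ) (u v w : TangentSpace J y) :
    curvature y u (c • v) w = c • curvature y u v w := by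
  rw [curvature_swap, curvature_smul_left, curvature_swap v, smul_neg, neg_neg]

theorem curvature_add_right (u v w w' : TangentSpace J y) :
    curvature y u v (w + w') = curvature y u v w + curvature y u v w' := by
  simp only [curvature_eq_secondDeriv, secondDeriv_congr (extend_add w w'),
    secondDeriv_add (smoothAlong_extend w) (smoothAlong_extend w')]
  abel

theorem curvature_smul_right (c : ℝ) (u v w : TangentSpace J y) :
    curvature y u v (c • w) = c • curvature y u v w := by
  simp only [curvature_eq_secondDeriv, secondDeriv_congr (extend_smul c w),
    secondDeriv_smul c (smoothAlong_extend w), smul_sub]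

/-- The bilinear map `(v, w) ↦ R(u, v)w`. -/
def curvatureBilin (y : N) (u : TangentSpace J y) :
    TangentSpace J y →ₗ[ℝ] TangentSpace J y →ₗ[ℝ] TangentSpace J y :=
  LinearMap.mk₂ ℝ (curvature y u) (curvature_add_mid u) (fun c v w ↦ curvature_smul_mid c u v w)
    (curvature_add_right u) (fun c v w ↦ curvature_smul_right c u v w)

end LeviCivitaRules

section CurvatureSymmetries

open VectorField

variable {F : Type*} [NormedAddCommGroup F] [NormedSpace ℝ F] [FiniteDimensional ℝ F]
  {H' : Type*} [TopologicalSpace H'] {J : ModelWithCorners ℝ F H'}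
  {N : Type*} [TopologicalSpace N] [ChartedSpace H' N] [IsManifold J ∞ N]
  [RiemannianBundle (fun y : N ↦ TangentSpace J y)]
  [IsContMDiffRiemannianBundle J ∞ F (fun y : N ↦ TangentSpace J y)]
  {y : N} {U V W Z : ∀ q : N, TangentSpace J q}

theorem mvfderiv_mvfderiv_inner (hV : SmoothField ∞ V y)
    (hW : SmoothField ∞ W y) (hZ : SmoothField ∞ Z y) :
    d% (fun q ↦ d% (fun q ↦ ⟪W q, Z q⟫_ℝ) q (V q)) y (U y) =
      ⟪leviCivita (fun q ↦ leviCivita W q (V q)) y (U y), Z y⟫_ℝ +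
        ⟪leviCivita W y (V y), leviCivita Z y (U y)⟫_ℝ +
      (⟪leviCivita W y (U y), leviCivita Z y (V y)⟫_ℝ +
        ⟪W y, leviCivita (fun q ↦ leviCivita Z q (V q)) y (U y)⟫_ℝ) := by
  have h : (fun q ↦ d% (fun q ↦ ⟪W q, Z q⟫_ℝ) q (V q)) =ᶠ[𝓝 y]
      fun q ↦ ⟪leviCivita W q (V q), Z q⟫_ℝ + ⟪W q, leviCivita Z q (V q)⟫_ℝ := by
    filter_upwards [hW.eventually 1, hZ.eventually 1] with q hWq hZq
    exact mvfderiv_inner_field (hWq.diffAlong (by simp)) (hZq.diffAlong (by simp))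
  have hVW := (hW.leviCivita hV).diffAlong (by simp)
  have hVZ := (hZ.leviCivita hV).diffAlong (by simp)
  have hW' : DiffField W y := hW.diffAlong (by simp)
  have hZ' : DiffField Z y := hZ.diffAlong (by simp)
  rw [mvfderiv_congr h, mvfderiv_fun_add (DiffAlong.inner hVW hZ') (DiffAlong.inner hW' hVZ),
    add_apply, mvfderiv_inner_field hVW hZ', mvfderiv_inner_field hW' hVZ]

theorem inner_curvature_swap_right (u v w z : TangentSpace J y) :
    ⟪curvature y u v w, z⟫_ℝ = - ⟪curvature y u v z, w⟫_ℝ := by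
  have hu := smoothAlong_extend (F := F) u
  have hv := smoothAlong_extend (F := F) v
  have hw := smoothAlong_extend (F := F) w
  have hz := smoothAlong_extend (F := F) z
  have h := mlieBracket_apply_scalar (hu.of_le (by norm_cast)) (hv.of_le (by norm_cast))
    (f := fun q : N ↦ ⟪(FiberBundle.extend F w : ∀ q : N, TangentSpace J q) q,
      FiberBundle.extend F z q⟫_ℝ) ((SmoothAlong.inner (k := ⊤) hw hz).of_le (by norm_cast))
  rw [mvfderiv_mvfderiv_inner hv hw hz, mvfderiv_mvfderiv_inner hu hw hz,
    mvfderiv_inner_field (hw.diffAlong (by simp)) (hz.diffAlong (by simp))] at h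
  simp only [curvature, curvatureField, inner_sub_left]
  simp only [FiberBundle.extend_apply_self] at h ⊢
  simp only [real_inner_comm w]
  linarith

/-- The first Bianchi identity. -/
theorem curvature_bianchi (u v w : TangentSpace J y) :
    curvature y u v w + curvature y v w u + curvature y w u v = 0 := by
  have : IsManifold J (minSmoothness ℝ 3) N := by simp; infer_instance
  have key (a b c : TangentSpace J y) :
      leviCivita (fun q ↦ leviCivita (FiberBundle.extend F c) q (FiberBundle.extend F b q)) y a -
      leviCivita (fun q ↦ leviCivita (FiberBundle.extend F b) q (FiberBundle.extend F c q)) y a -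
      leviCivita (FiberBundle.extend F a) y
        (mlieBracket J (FiberBundle.extend F b) (FiberBundle.extend F c) y) =
      mlieBracket J (FiberBundle.extend F a)
        (mlieBracket J (FiberBundle.extend F b) (FiberBundle.extend F c)) y := by
    have hb := smoothAlong_extend (F := F) b
    have hc := smoothAlong_extend (F := F) c
    have hbc := (hc.leviCivita hb).sub (hb.leviCivita hc)
    have h : ∀ᶠ q in 𝓝 y, mlieBracket J (FiberBundle.extend F b) (FiberBundle.extend F c) q =
        leviCivita (FiberBundle.extend F c) q (FiberBundle.extend F b q) -
        leviCivita (FiberBundle.extend F b) q (FiberBundle.extend F c q) := by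
      filter_upwards [hb.eventually 2, hc.eventually 2] with q hbq hcq
      exact (leviCivita_sub hbq hcq).symm
    have hbr : SmoothField ∞
        (mlieBracket J (FiberBundle.extend F b) (FiberBundle.extend F c)) y :=
      smoothField_mlieBracket hb hc
    have h1 := leviCivita_sub ((smoothAlong_extend (F := F) a).of_le (by norm_cast))
      (hbr.of_le (by norm_cast))
    rw [← h1, leviCivita_congr h, FiberBundle.extend_apply_self]
    congr 1
    have h2 := leviCivita_add (u := a) (hbc.diffAlong (by simp))
      ((hb.leviCivita hc).diffAlong (by simp))
    rw [sub_eq_iff_eq_add, ← h2]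
    exact leviCivita_congr (.of_forall fun q ↦ by simp)
  have h1 := key u v w
  have h2 := key v w u
  have h3 := key w u v
  have hj := leibniz_identity_mlieBracket_apply (I := J) (x := y)
    (U := FiberBundle.extend F u) (V := FiberBundle.extend F v) (W := FiberBundle.extend F w)
    (by simpa using! (smoothAlong_extend u).of_le (by norm_cast))
    (by simpa using! (smoothAlong_extend v).of_le (by norm_cast))
    (by simpa using! (smoothAlong_extend w).of_le (by norm_cast))
  rw [mlieBracket_swap_apply (V := mlieBracket J _ _),
    mlieBracket_swap (V := FiberBundle.extend F u) (W := FiberBundle.extend F w)] at hj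
  have hj2 : mlieBracket J (FiberBundle.extend F v)
      (-mlieBracket J (FiberBundle.extend F w) (FiberBundle.extend F u)) y =
      - mlieBracket J (FiberBundle.extend F v)
      (mlieBracket J (FiberBundle.extend F w) (FiberBundle.extend F u)) y := by
    have h := mlieBracket_const_smul_right (I := J) (V := FiberBundle.extend F v) (c := (-1 : ℝ))
      (W := mlieBracket J (FiberBundle.extend F w) (FiberBundle.extend F u)) (x := y)
      ((smoothField_mlieBracket (smoothAlong_extend w) (smoothAlong_extend u)).diffAlong (by simp))
    simpa using h
  rw [hj2] at hj
  simp only [curvature, curvatureField]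
  simp only [FiberBundle.extend_apply_self]
  rw [← h1, ← h2, ← h3] at hj
  rw [← sub_eq_zero] at hj
  rw [← hj]
  abel

/-- The pair symmetry of the curvature tensor. -/
theorem inner_curvature_pair (u v w z : TangentSpace J y) :
    ⟪curvature y u v w, z⟫_ℝ = ⟪curvature y w z u, v⟫_ℝ := by
  let R (a b c d : TangentSpace J y) : ℝ := ⟪curvature y a b c, d⟫_ℝ
  have h1 (a b c d) : R a b c d = - R b a c d := by
    simp only [R]; rw [curvature_swap, inner_neg_left]
  have h2 (a b c d) : R a b c d = - R a b d c := inner_curvature_swap_right a b c d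
  have h3 (a b c d) : R a b c d + R b c a d + R c a b d = 0 := by
    simp only [R, ← inner_add_left, curvature_bianchi, inner_zero_left]
  change R u v w z = R w z u v
  linarith [h3 u v w z, h3 v w z u, h3 w z u v, h3 z u v w, h1 u v w z, h1 v w u z, h1 w u v z,
    h1 v w z u, h1 w z v u, h1 z v w u, h1 w z u v, h1 z u w v, h1 u w z v, h1 z u v w, h1 u v z w,
    h1 v z u w, h2 u v w z, h2 v w u z, h2 w u v z, h2 w z v u, h2 z v w u, h2 z u w v,
    h2 w z u v, h2 u w z v, h2 z u v w, h2 u v z w, h2 v z u w, h2 v w z u]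

end CurvatureSymmetries

section CurvatureAlong

open VectorField

variable {E : Type*} [NormedAddCommGroup E] [NormedSpace ℝ E] [FiniteDimensional ℝ E]
  {H : Type*} [TopologicalSpace H] {I : ModelWithCorners ℝ E H}
  {M : Type*} [TopologicalSpace M] [ChartedSpace H M] [IsManifold I ∞ M]
  {F : Type*} [NormedAddCommGroup F] [NormedSpace ℝ F] [FiniteDimensional ℝ F]
  {H' : Type*} [TopologicalSpace H'] {J : ModelWithCorners ℝ F H'}
  {N : Type*} [TopologicalSpace N] [ChartedSpace H' N] [IsManifold J ∞ N]
  [RiemannianBundle (fun y : N ↦ TangentSpace J y)]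
  [IsContMDiffRiemannianBundle J ∞ F (fun y : N ↦ TangentSpace J y)]
  {φ : M → N} {x : M} {V Z : ∀ p, TangentSpace J (φ p)} {W : ∀ q : N, TangentSpace J q}
  {X Y : ∀ p : M, TangentSpace I p}

/-- The covariant derivative of a combination of restrictions of vector fields. -/
theorem pullbackCov_of_eq_sum {ι : Type*} [Fintype ι] {f : ι → M → ℝ}
    {e : ι → ∀ q : N, TangentSpace J q} (hφ : MDifferentiableAt I J φ x)
    (hf : ∀ i, MDifferentiableAt I 𝓘(ℝ) (f i) x) (he : ∀ i, DiffField (e i) (φ x))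
    (h : ∀ᶠ p in 𝓝 x, V p = ∑ i, f i p • e i (φ p)) (u : TangentSpace I x) :
    pullbackCov I J φ V x u = ∑ i, ((d% (f i) x u) • e i (φ x) +
      f i x • leviCivita (e i) (φ x) (mfderiv I J φ x u)) := by
  rw [pullbackCov_congr h, pullbackCov_sum Finset.univ hφ
    fun i _ ↦ ((he i).comp_map hφ).smul (hf i)]
  refine Finset.sum_congr rfl fun i _ ↦ ?_
  rw [pullbackCov_smul (V := fun p ↦ e i (φ p)) (hf i) ((he i).comp_map hφ),
    pullbackCov_comp_map hφ (he i)]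

theorem leviCivita_along_eventuallyEq (hφ : ContinuousAt φ x) :
    ∀ᶠ p in 𝓝 x, leviCivita W (φ p) (Z p) = ∑ j, chartCoeff φ Z x j p •
      leviCivita W (φ p) (FiberBundle.extend F (chartVec J (φ x) j) (φ p)) := by
  filter_upwards [eventually_eq_sum_chartCoeff hφ Z] with p hp
  conv_lhs => rw [hp]
  rw [leviCivita_dir_sum]
  simp only [leviCivita_dir_smul]

theorem SmoothAlong.leviCivita_along (hφ : ContMDiffAt I J ∞ φ x) (hW : SmoothField ∞ W (φ x))
    (hZ : SmoothAlong I ∞ φ Z x) :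
    SmoothAlong I ∞ φ (fun p ↦ RiemannianImmersion.leviCivita W (φ p) (Z p)) x := by
  refine SmoothAlong.congr (SmoothAlong.sum Finset.univ hφ fun j _ ↦ ?_)
    (leviCivita_along_eventuallyEq hφ.continuousAt)
  exact ((hW.leviCivita (smoothAlong_extend _)).comp_map hφ).smul (hZ.chartCoeff j)

/-- The chain rule for the second covariant derivative along a map. -/
theorem pullbackCov_leviCivita_along (hφ : ContMDiffAt I J ∞ φ x) (hW : SmoothField ∞ W (φ x))
    (hZ : SmoothAlong I ∞ φ Z x) (u : TangentSpace I x) :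
    pullbackCov I J φ (fun p ↦ leviCivita W (φ p) (Z p)) x u =
      secondDeriv W (φ x) (mfderiv I J φ x u) (Z x) +
        leviCivita W (φ x) (pullbackCov I J φ Z x u) := by
  have hφ' : MDifferentiableAt I J φ x := hφ.mdifferentiableAt (by simp)
  have hc (j) := (hZ.chartCoeff j).mdifferentiableAt (by simp)
  rw [pullbackCov_of_eq_sum hφ' hc
      (fun j ↦ diffField_leviCivita_extend hW (chartVec J (φ x) j))
      (leviCivita_along_eventuallyEq hφ.continuousAt),
    pullbackCov_of_eq_sum hφ' hc
      (fun j ↦ diffField_extend (chartVec J (φ x) j))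
      (eventually_eq_sum_chartCoeff hφ.continuousAt Z), leviCivita_dir_sum]
  have hZx := (eventually_eq_sum_chartCoeff hφ.continuousAt Z).self_of_nhds
  have hs : secondDeriv W (φ x) (mfderiv I J φ x u) (Z x) = ∑ j, chartCoeff φ Z x j x •
      secondDeriv W (φ x) (mfderiv I J φ x u) (chartVec J (φ x) j) := by
    let l : TangentSpace J (φ x) →ₗ[ℝ] TangentSpace J (φ x) :=
      { toFun := secondDeriv W (φ x) (mfderiv I J φ x u)
        map_add' := secondDeriv_add_right hW _
        map_smul' := fun c v ↦ secondDeriv_smul_right hW c _ v }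
    change l (Z x) = _
    conv_lhs => rw [hZx]
    rw [map_sum]
    simp only [map_smul, FiberBundle.extend_apply_self]
    rfl
  rw [hs, ← Finset.sum_add_distrib]
  refine Finset.sum_congr rfl fun j _ ↦ ?_
  simp only [leviCivita_dir_add, leviCivita_dir_smul, secondDeriv, FiberBundle.extend_apply_self]
  module

theorem pullbackCov_eventuallyEq (hφ : ContMDiff I J ∞ φ) (hV : SmoothAlong I ∞ φ V x)
    (X : ∀ p : M, TangentSpace I p) :
    ∀ᶠ p in 𝓝 x, pullbackCov I J φ V p (X p) = ∑ i, ((d% (chartCoeff φ V x i) p (X p)) •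
      FiberBundle.extend F (chartVec J (φ x) i) (φ p) + chartCoeff φ V x i p •
      leviCivita (FiberBundle.extend F (chartVec J (φ x) i)) (φ p) (mfderiv I J φ p (X p))) := by
  have hc (i) : ∀ᶠ p in 𝓝 x, ContMDiffAt I 𝓘(ℝ) 1 (chartCoeff φ V x i) p :=
    contMDiffAt_iff_contMDiffAt_nhds (by simp) |>.1
      ((hV.chartCoeff i).of_le (m := 1) (by norm_cast))
  have he (i) : ∀ᶠ p in 𝓝 x, SmoothField 1
      (FiberBundle.extend F (chartVec J (φ x) i)) (φ p) :=
    hφ.continuous.continuousAt.eventually ((smoothAlong_extend (chartVec J (φ x) i)).eventually 1)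
  filter_upwards [(eventually_eq_sum_chartCoeff hφ.continuous.continuousAt V).eventually_nhds,
    Filter.eventually_all.2 hc, Filter.eventually_all.2 he] with p hp hcp hep
  exact pullbackCov_of_eq_sum (hφ.mdifferentiableAt (by simp))
    (fun i ↦ (hcp i).mdifferentiableAt (by simp)) (fun i ↦ (hep i).diffAlong (by simp)) hp (X p)

theorem SmoothAlong.pullbackCov (hφ : ContMDiff I J ∞ φ) (hV : SmoothAlong I ∞ φ V x)
    (hX : SmoothField ∞ X x) :
    SmoothAlong I ∞ φ (fun p ↦ RiemannianImmersion.pullbackCov I J φ V p (X p)) x := by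
  refine SmoothAlong.congr (SmoothAlong.sum Finset.univ (hφ x) fun i _ ↦ ?_)
    (pullbackCov_eventuallyEq hφ hV X)
  have hXφ : SmoothAlong I ∞ φ (fun p ↦ _root_.mfderiv I J φ p (X p)) x :=
    SmoothAlong.mfderivAt (hφ x) hX (by simp)
  exact (((smoothAlong_extend _).comp_map (hφ x)).smul
      (SmoothAlong.mvfderiv (hV.chartCoeff i) hX (by simp))).add
    ((SmoothAlong.leviCivita_along (hφ x) (smoothAlong_extend _) hXφ).smul (hV.chartCoeff i))

/-- The curvature of the induced connection is the pull back of the curvature. -/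
theorem pullbackCov_curvature (hφ : ContMDiff I J ∞ φ) (hV : SmoothAlong I ∞ φ V x)
    (hX : SmoothField ∞ X x) (hY : SmoothField ∞ Y x) :
    pullbackCov I J φ (fun p ↦ pullbackCov I J φ V p (Y p)) x (X x) -
      pullbackCov I J φ (fun p ↦ pullbackCov I J φ V p (X p)) x (Y x) -
      pullbackCov I J φ V x (mlieBracket I X Y x) =
    curvature (φ x) (mfderiv I J φ x (X x)) (mfderiv I J φ x (Y x)) (V x) := by
  have hφ' : MDifferentiableAt I J φ x := hφ.mdifferentiableAt (by simp)
  have key {X Y : ∀ p : M, TangentSpace I p} (hX : SmoothField ∞ X x) (hY : SmoothField ∞ Y x) :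
      pullbackCov I J φ (fun p ↦ pullbackCov I J φ V p (Y p)) x (X x) =
      ∑ i, ((d% (fun p ↦ d% (chartCoeff φ V x i) p (Y p)) x (X x)) • chartVec J (φ x) i +
        (d% (chartCoeff φ V x i) x (Y x)) •
          leviCivita (FiberBundle.extend F (chartVec J (φ x) i)) (φ x) (mfderiv I J φ x (X x)) +
        ((d% (chartCoeff φ V x i) x (X x)) •
          leviCivita (FiberBundle.extend F (chartVec J (φ x) i)) (φ x) (mfderiv I J φ x (Y x)) +
        chartCoeff φ V x i x •
          (secondDeriv (FiberBundle.extend F (chartVec J (φ x) i)) (φ x) (mfderiv I J φ x (X x))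
            (mfderiv I J φ x (Y x)) + leviCivita (FiberBundle.extend F (chartVec J (φ x) i)) (φ x)
            (pullbackCov I J φ (fun p ↦ mfderiv I J φ p (Y p)) x (X x))))) := by
    have hYφ : SmoothAlong I ∞ φ (fun p ↦ mfderiv I J φ p (Y p)) x :=
      SmoothAlong.mfderivAt (hφ x) hY (by simp)
    have hc (i) := (hV.chartCoeff i).mdifferentiableAt (by simp)
    have hdc (i) : MDifferentiableAt I 𝓘(ℝ) (fun p ↦ d% (chartCoeff φ V x i) p (Y p)) x :=
      (SmoothAlong.mvfderiv (hV.chartCoeff i) hY (l := ∞) (by simp)).mdifferentiableAt (by simp)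
    have he (i) : DiffField (FiberBundle.extend F (chartVec J (φ x) i)) (φ x) := diffField_extend _
    have hl (i) := (SmoothAlong.leviCivita_along (hφ x) (smoothAlong_extend (chartVec J (φ x) i))
      hYφ).diffAlong (by simp)
    rw [pullbackCov_congr (pullbackCov_eventuallyEq hφ hV Y), pullbackCov_sum _ hφ' fun i _ ↦
      (((he i).comp_map hφ').smul (hdc i)).add ((hl i).smul (hc i))]
    refine Finset.sum_congr rfl fun i _ ↦ ?_
    rw [pullbackCov_add (((he i).comp_map hφ').smul (hdc i)) ((hl i).smul (hc i)),
      pullbackCov_smul (V := fun p ↦ FiberBundle.extend F (chartVec J (φ x) i) (φ p)) (hdc i)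
        ((he i).comp_map hφ'), pullbackCov_comp_map hφ' (he i),
      pullbackCov_smul (V := fun p ↦ leviCivita (FiberBundle.extend F (chartVec J (φ x) i)) (φ p)
        (mfderiv I J φ p (Y p))) (hc i) (hl i), pullbackCov_leviCivita_along (hφ x)
        (smoothAlong_extend _) hYφ, FiberBundle.extend_apply_self]
  have hVx := (eventually_eq_sum_chartCoeff (hφ x).continuousAt V).self_of_nhds
  have hR : curvature (φ x) (mfderiv I J φ x (X x)) (mfderiv I J φ x (Y x)) (V x) =
      ∑ i, chartCoeff φ V x i x • curvature (φ x) (mfderiv I J φ x (X x))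
        (mfderiv I J φ x (Y x)) (chartVec J (φ x) i) := by
    let l : TangentSpace J (φ x) →ₗ[ℝ] TangentSpace J (φ x) :=
      { toFun := curvature (φ x) (mfderiv I J φ x (X x)) (mfderiv I J φ x (Y x))
        map_add' := curvature_add_right _ _
        map_smul' := fun c v ↦ curvature_smul_right c _ _ v }
    change l (V x) = _
    conv_lhs => rw [hVx]
    rw [map_sum]
    simp only [map_smul, FiberBundle.extend_apply_self]
    rfl
  rw [key hX hY, key hY hX, hR, pullbackCov_of_eq_sum hφ'
    (fun i ↦ (hV.chartCoeff i).mdifferentiableAt (by simp))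
    (fun i ↦ diffField_extend (chartVec J (φ x) i))
    (eventually_eq_sum_chartCoeff hφ.continuous.continuousAt V), ← Finset.sum_sub_distrib,
    ← Finset.sum_sub_distrib]
  refine Finset.sum_congr rfl fun i _ ↦ ?_
  rw [curvature_eq_secondDeriv, ← mlieBracket_apply_scalar (hX.of_le (by norm_cast))
    (hY.of_le (by norm_cast)) ((hV.chartCoeff i).of_le (by norm_cast)),
    ← pullbackCov_mfderiv_sub hφ (hX.of_le (by norm_cast)) (hY.of_le (by norm_cast)),
    leviCivita_dir_sub, FiberBundle.extend_apply_self]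
  module

end CurvatureAlong

/-- The trace of a bilinear map does not depend on the Parseval family that computes it. -/
theorem sum_apply_self_eq_of_parseval {ι κ V G : Type*} [Fintype ι] [Fintype κ]
    [NormedAddCommGroup V] [InnerProductSpace ℝ V] [AddCommGroup G] [Module ℝ G]
    (B : V →ₗ[ℝ] V →ₗ[ℝ] G) {f : ι → V} {g : κ → V} (hf : ∀ v, ∑ i, ⟪f i, v⟫_ℝ • f i = v)
    (hg : ∀ v, ∑ j, ⟪g j, v⟫_ℝ • g j = v) : ∑ i, B (f i) (f i) = ∑ j, B (g j) (g j) := by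
  calc ∑ i, B (f i) (f i) = ∑ i, ∑ j, ⟪g j, f i⟫_ℝ • B (f i) (g j) := by
        refine Finset.sum_congr rfl fun i _ ↦ ?_
        simp only [← map_smul, ← map_sum, hg]
    _ = ∑ j, B (∑ i, ⟪f i, g j⟫_ℝ • f i) (g j) := by
        rw [Finset.sum_comm]
        simp only [map_sum, map_smul, LinearMap.sum_apply, LinearMap.smul_apply]
        simp only [real_inner_comm]
    _ = _ := by simp only [hf]

section SecondFundamentalForm

open VectorField

variable {E : Type*} [NormedAddCommGroup E] [NormedSpace ℝ E] [FiniteDimensional ℝ E]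
  {H : Type*} [TopologicalSpace H] {I : ModelWithCorners ℝ E H}
  {M : Type*} [TopologicalSpace M] [ChartedSpace H M] [IsManifold I ∞ M]
  [RiemannianBundle (fun x : M ↦ TangentSpace I x)]
  [IsContMDiffRiemannianBundle I ∞ E (fun x : M ↦ TangentSpace I x)]
  {F : Type*} [NormedAddCommGroup F] [NormedSpace ℝ F] [FiniteDimensional ℝ F]
  {H' : Type*} [TopologicalSpace H'] {J : ModelWithCorners ℝ F H'}
  {N : Type*} [TopologicalSpace N] [ChartedSpace H' N] [IsManifold J ∞ N]
  [RiemannianBundle (fun y : N ↦ TangentSpace J y)]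
  [IsContMDiffRiemannianBundle J ∞ F (fun y : N ↦ TangentSpace J y)]
  {φ : M → N} {x : M} {X Y Z : ∀ p : M, TangentSpace I p}

theorem pullbackCov_dir_add {V : ∀ p, TangentSpace J (φ p)} (u v : TangentSpace I x) :
    pullbackCov I J φ V x (u + v) = pullbackCov I J φ V x u + pullbackCov I J φ V x v :=
  (pullbackCovLin I J φ x V).map_add u v

theorem pullbackCov_dir_sub {V : ∀ p, TangentSpace J (φ p)} (u v : TangentSpace I x) :
    pullbackCov I J φ V x (u - v) = pullbackCov I J φ V x u - pullbackCov I J φ V x v :=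
  (pullbackCovLin I J φ x V).map_sub u v

theorem pullbackCov_dir_smul {V : ∀ p, TangentSpace J (φ p)} (c : ℝ) (u : TangentSpace I x) :
    pullbackCov I J φ V x (c • u) = c • pullbackCov I J φ V x u :=
  (pullbackCovLin I J φ x V).map_smul c u

theorem secondFundamentalField_comm (hφ : ContMDiff I J ∞ φ) (hX : SmoothField 2 X x)
    (hY : SmoothField 2 Y x) :
    secondFundamentalField I J φ X Y x = secondFundamentalField I J φ Y X x := by
  have h := pullbackCov_mfderiv_sub hφ hX hY
  rw [← leviCivita_sub hX hY, map_sub] at h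
  simp only [secondFundamentalField]
  rw [sub_eq_sub_iff_sub_eq_sub]
  exact h

/-- `secondFundamentalField` is tensorial. -/
theorem secondFundamentalField_eq (hφ : ContMDiff I J ∞ φ)
    (hY : SmoothField 2 Y x) :
    secondFundamentalField I J φ X Y x = secondFundamentalForm I J φ x (X x) (Y x) := by
  have key {X X' Y : ∀ p : M, TangentSpace I p} (h : X x = X' x) :
      secondFundamentalField I J φ X Y x = secondFundamentalField I J φ X' Y x := by
    simp only [secondFundamentalField, h]
  have hX' : SmoothField 2 (FiberBundle.extend E (X x)) x :=
    (smoothAlong_extend (X x)).of_le (by norm_cast)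
  have hY' : SmoothField 2 (FiberBundle.extend E (Y x)) x :=
    (smoothAlong_extend (Y x)).of_le (by norm_cast)
  rw [secondFundamentalForm, key (FiberBundle.extend_apply_self E (X x)).symm,
    secondFundamentalField_comm hφ hX' hY, key (FiberBundle.extend_apply_self E (Y x)).symm,
    secondFundamentalField_comm hφ hY' hX']

theorem secondFundamentalForm_comm (hφ : ContMDiff I J ∞ φ) (u v : TangentSpace I x) :
    secondFundamentalForm I J φ x u v = secondFundamentalForm I J φ x v u :=
  secondFundamentalField_comm hφ ((smoothAlong_extend u).of_le (by norm_cast))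
    ((smoothAlong_extend v).of_le (by norm_cast))

/-- The Gauss formula. -/
theorem pullbackCov_mfderiv (hφ : ContMDiff I J ∞ φ) (hY : SmoothField 2 Y x)
    (u : TangentSpace I x) :
    pullbackCov I J φ (fun p ↦ mfderiv I J φ p (Y p)) x u =
      secondFundamentalForm I J φ x u (Y x) + mfderiv I J φ x (leviCivita Y x u) := by
  have h := secondFundamentalField_eq hφ (X := FiberBundle.extend E u) hY
  rw [secondFundamentalField, FiberBundle.extend_apply_self] at h
  rw [← h, sub_add_cancel]

theorem secondFundamentalForm_add_left (u u' v : TangentSpace I x) :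
    secondFundamentalForm I J φ x (u + u') v =
      secondFundamentalForm I J φ x u v + secondFundamentalForm I J φ x u' v := by
  simp only [secondFundamentalForm, secondFundamentalField, FiberBundle.extend_apply_self,
    pullbackCov_dir_add, leviCivita_dir_add, map_add]
  abel

theorem secondFundamentalForm_smul_left (c : ℝ) (u v : TangentSpace I x) :
    secondFundamentalForm I J φ x (c • u) v = c • secondFundamentalForm I J φ x u v := by
  simp only [secondFundamentalForm, secondFundamentalField, FiberBundle.extend_apply_self,
    pullbackCov_dir_smul, leviCivita_dir_smul, map_smul, smul_sub]

/-- The second fundamental form as a bilinear map. -/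
def secondFundamentalBilin (hφ : ContMDiff I J ∞ φ) (x : M) :
    TangentSpace I x →ₗ[ℝ] TangentSpace I x →ₗ[ℝ] TangentSpace J (φ x) :=
  LinearMap.mk₂ ℝ (secondFundamentalForm I J φ x) secondFundamentalForm_add_left
    secondFundamentalForm_smul_left
    (fun u v v' ↦ by
      simp only [secondFundamentalForm_comm hφ u, secondFundamentalForm_add_left])
    (fun c u v ↦ by
      simp only [secondFundamentalForm_comm hφ u, secondFundamentalForm_smul_left])

theorem SmoothAlong.secondFundamentalForm (hφ : ContMDiff I J ∞ φ) (hX : SmoothField ∞ X x)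
    (hY : SmoothField ∞ Y x) :
    SmoothAlong I ∞ φ
      (fun p ↦ RiemannianImmersion.secondFundamentalForm I J φ p (X p) (Y p)) x := by
  have h1 : SmoothAlong I ∞ φ (fun p ↦ _root_.mfderiv I J φ p (Y p)) x :=
    SmoothAlong.mfderivAt (hφ x) hY (by simp)
  have h2 : SmoothAlong I ∞ φ (fun p ↦ _root_.mfderiv I J φ p
      (RiemannianImmersion.leviCivita Y p (X p))) x :=
    SmoothAlong.mfderivAt (hφ x) (hY.leviCivita hX) (by simp)
  refine ((h1.pullbackCov hφ hX).sub h2).congr ?_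
  filter_upwards [hY.eventually 2] with p hYp
  exact (secondFundamentalField_eq hφ hYp).symm

theorem sum_inner_smul_of_orthonormalBasis {ι : Type*} [Fintype ι]
    (e : OrthonormalBasis ι ℝ (TangentSpace I x)) (v : TangentSpace I x) :
    ∑ i, ⟪e i, v⟫_ℝ • e i = v :=
  e.sum_repr' v

theorem tensionField_eq (hφ : ContMDiff I J ∞ φ) {ι : Type*} [Fintype ι]
    {e : ι → TangentSpace I x} (he : ∀ v, ∑ i, ⟪e i, v⟫_ℝ • e i = v) :
    tensionField I J φ x = ∑ i, secondFundamentalForm I J φ x (e i) (e i) :=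
  sum_apply_self_eq_of_parseval (secondFundamentalBilin hφ x)
    (sum_inner_smul_of_orthonormalBasis (tangentONB x)) he

theorem smoothAlong_tensionField (hφ : ContMDiff I J ∞ φ) (x : M) :
    SmoothAlong I ∞ φ (tensionField I J φ) x := by
  obtain ⟨e, he, -, hon⟩ := exists_orthonormal_frame (tangentONB (J := I) x)
    (tangentONB (J := I) x).orthonormal
  refine (SmoothAlong.sum Finset.univ (hφ x) fun i _ ↦
    SmoothAlong.secondFundamentalForm hφ (he i) (he i)).congr ?_
  filter_upwards [hon] with p hp
  exact tensionField_eq hφ (sum_inner_smul_of_orthonormal hp rfl)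

theorem IsIsometricImmersion.inner_secondFundamentalForm (hφ : IsIsometricImmersion I J φ)
    (u v w : TangentSpace I x) :
    ⟪secondFundamentalForm I J φ x u v, mfderiv I J φ x w⟫_ℝ = 0 := by
  have key (u v w : TangentSpace I x) :
      ⟪secondFundamentalForm I J φ x u v, mfderiv I J φ x w⟫_ℝ =
        - ⟪secondFundamentalForm I J φ x u w, mfderiv I J φ x v⟫_ℝ := by
    have hs (v : TangentSpace I x) : SmoothField 2 (FiberBundle.extend E v) x :=
      (smoothAlong_extend v).of_le (by norm_cast)
    have hd (v : TangentSpace I x) :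
        DiffAlong I φ (fun p ↦ mfderiv I J φ p (FiberBundle.extend E v p)) x :=
      (SmoothAlong.mfderivAt (l := ∞) (hφ.contMDiff x) (smoothAlong_extend v) (by simp)).diffAlong
        (by simp)
    have h := mvfderiv_inner (u := u) (hd v) (hd w)
    simp only [hφ.inner_mfderiv] at h
    rw [mvfderiv_inner_field (diffField_extend v) (diffField_extend w),
      pullbackCov_mfderiv hφ.contMDiff (hs v), pullbackCov_mfderiv hφ.contMDiff (hs w)] at h
    simp only [inner_add_left, inner_add_right, hφ.inner_mfderiv,
      FiberBundle.extend_apply_self] at h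
    rw [real_inner_comm (secondFundamentalForm I J φ x u w)] at h
    linarith
  have h1 := key u v w
  have h2 := key v w u
  have h3 := key w u v
  rw [secondFundamentalForm_comm hφ.contMDiff w v] at h3
  rw [secondFundamentalForm_comm hφ.contMDiff v u] at h2
  rw [secondFundamentalForm_comm hφ.contMDiff w u] at h3
  linarith

end SecondFundamentalForm

theorem mvfderiv_fun_sum {E H M ι : Type*} [NormedAddCommGroup E] [NormedSpace ℝ E]
    [TopologicalSpace H] {I : ModelWithCorners ℝ E H} [TopologicalSpace M] [ChartedSpace H M]
    {s : Finset ι} {f : ι → M → ℝ} {x : M} (hf : ∀ i ∈ s, MDifferentiableAt I 𝓘(ℝ) (f i) x) :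
    d% (fun p ↦ ∑ i ∈ s, f i p) x = ∑ i ∈ s, d% (f i) x := by
  classical
  suffices MDifferentiableAt I 𝓘(ℝ) (fun p ↦ ∑ i ∈ s, f i p) x ∧
    d% (fun p ↦ ∑ i ∈ s, f i p) x = ∑ i ∈ s, d% (f i) x from this.2
  induction s using Finset.induction_on with
  | empty => simpa using ⟨mdifferentiableAt_const, mvfderiv_const 0⟩
  | insert a s ha ih =>
    obtain ⟨h1, h2⟩ := ih fun i hi ↦ hf i (by simp [hi])
    have h3 := hf a (by simp)
    simp only [Finset.sum_insert ha]
    exact ⟨h3.add h1, by rw [mvfderiv_fun_add h3 h1, h2]⟩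

section GlobalField

variable {E : Type*} [NormedAddCommGroup E] [NormedSpace ℝ E] [FiniteDimensional ℝ E]
  {H : Type*} [TopologicalSpace H] {I : ModelWithCorners ℝ E H}
  {M : Type*} [TopologicalSpace M] [T2Space M] [ChartedSpace H M] [IsManifold I ∞ M]

/-- Every tangent vector is the value of a smooth global vector field. -/
theorem exists_contMDiff_field {x : M} (u : TangentSpace I x) :
    ∃ X : ∀ p : M, TangentSpace I p,
      ContMDiff I I.tangent ∞ (fun p ↦ (⟨p, X p⟩ : TangentBundle I M)) ∧ X x = u := by
  obtain ⟨s, hs, hX⟩ := FiberBundle.exists_contMDiffOn_extend (k := ∞) I E u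
  obtain ⟨f, -, hf⟩ := (SmoothBumpFunction.nhds_basis_tsupport (I := I) x).mem_iff.1
    (interior_mem_nhds.2 hs)
  refine ⟨fun p ↦ f p • FiberBundle.extend E u p, ?_, ?_⟩
  · exact ContMDiffOn.smul_section_of_tsupport (ψ := f) f.contMDiff.contMDiffOn isOpen_interior hf
      (hX.mono interior_subset)
  · simp only [f.eq_one, one_smul, FiberBundle.extend_apply_self]

end GlobalField

section ParallelTension

open VectorField

variable {E : Type*} [NormedAddCommGroup E] [NormedSpace ℝ E] [FiniteDimensional ℝ E]
  {H : Type*} [TopologicalSpace H] {I : ModelWithCorners ℝ E H}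
  {M : Type*} [TopologicalSpace M] [ChartedSpace H M] [IsManifold I ∞ M]
  [RiemannianBundle (fun x : M ↦ TangentSpace I x)]
  [IsContMDiffRiemannianBundle I ∞ E (fun x : M ↦ TangentSpace I x)]
  {F : Type*} [NormedAddCommGroup F] [NormedSpace ℝ F] [FiniteDimensional ℝ F]
  {H' : Type*} [TopologicalSpace H'] {J : ModelWithCorners ℝ F H'}
  {N : Type*} [TopologicalSpace N] [ChartedSpace H' N] [IsManifold J ∞ N]
  [RiemannianBundle (fun y : N ↦ TangentSpace J y)]
  [IsContMDiffRiemannianBundle J ∞ F (fun y : N ↦ TangentSpace J y)]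
  {φ : M → N} {x : M} {X Y Z : ∀ p : M, TangentSpace I p}

/-- `∇̄τ(φ)` is tangent to the immersion if the tension field is parallel in the normal bundle. -/
theorem HasParallelTension.exists_mfderiv_eq [T2Space M] (hpar : HasParallelTension I J φ) (x : M)
    (u : TangentSpace I x) :
    ∃ w, pullbackCov I J φ (tensionField I J φ) x u = mfderiv I J φ x w := by
  obtain ⟨X, hX, rfl⟩ := exists_contMDiff_field u
  have h := hpar X hX x
  rw [normalCov, Submodule.starProjection_apply_eq_zero_iff, normalSpace,
    Submodule.orthogonal_orthogonal] at h
  obtain ⟨w, hw⟩ := h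
  exact ⟨w, hw.symm⟩

theorem secondCov_eq_add_curvature (hφ : ContMDiff I J ∞ φ) {V : ∀ p, TangentSpace J (φ p)}
    (hV : SmoothAlong I ∞ φ V x) (hX : SmoothField ∞ X x) (hY : SmoothField ∞ Y x) :
    secondCov I J φ V X Y x = secondCov I J φ V Y X x +
      curvature (φ x) (mfderiv I J φ x (X x)) (mfderiv I J φ x (Y x)) (V x) := by
  rw [← pullbackCov_curvature hφ hV hX hY, ← leviCivita_sub (hX.of_le (by norm_cast))
    (hY.of_le (by norm_cast)), pullbackCov_dir_sub]
  simp only [secondCov]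
  abel

/-- `secondCov` is tensorial in both vector fields. -/
theorem secondCov_congr (hφ : ContMDiff I J ∞ φ) {V : ∀ p, TangentSpace J (φ p)}
    (hV : SmoothAlong I ∞ φ V x) {X' Y' : ∀ p : M, TangentSpace I p}
    (hY : SmoothField ∞ Y x) (hX' : SmoothField ∞ X' x) (hY' : SmoothField ∞ Y' x)
    (hXX' : X x = X' x) (hYY' : Y x = Y' x) :
    secondCov I J φ V X Y x = secondCov I J φ V X' Y' x := by
  have key {X X' Y : ∀ p : M, TangentSpace I p} (h : X x = X' x) :
      secondCov I J φ V X Y x = secondCov I J φ V X' Y x := by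
    simp only [secondCov, h]
  rw [key hXX', secondCov_eq_add_curvature hφ hV hX' hY,
    secondCov_eq_add_curvature hφ hV hX' hY', key hYY', hYY']

theorem IsIsometricImmersion.inner_tensionField_mfderiv (hφ : IsIsometricImmersion I J φ)
    (w : TangentSpace I x) : ⟪tensionField I J φ x, mfderiv I J φ x w⟫_ℝ = 0 := by
  simp [tensionField, sum_inner, hφ.inner_secondFundamentalForm]

/-- The Weingarten equation for the tension field. -/
theorem IsIsometricImmersion.inner_pullbackCov_tensionField (hφ : IsIsometricImmersion I J φ)
    (u w : TangentSpace I x) :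
    ⟪pullbackCov I J φ (tensionField I J φ) x u, mfderiv I J φ x w⟫_ℝ =
      - ⟪tensionField I J φ x, secondFundamentalForm I J φ x u w⟫_ℝ := by
  have hw := smoothAlong_extend (F := E) w
  have h := mvfderiv_inner (u := u) ((smoothAlong_tensionField hφ.contMDiff x).diffAlong (by simp))
    ((SmoothAlong.mfderivAt (l := ∞) (hφ.contMDiff x) hw (by simp)).diffAlong (by simp))
  simp only [hφ.inner_tensionField_mfderiv] at h
  rw [pullbackCov_mfderiv hφ.contMDiff (hw.of_le (by norm_cast)), inner_add_right,
    hφ.inner_tensionField_mfderiv, FiberBundle.extend_apply_self, mvfderiv_const,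
    zero_apply] at h
  linarith

theorem IsIsometricImmersion.mvfderiv_norm_sq_tensionField (hφ : IsIsometricImmersion I J φ)
    {u : TangentSpace I x}
    (htan : ∃ w, pullbackCov I J φ (tensionField I J φ) x u = mfderiv I J φ x w) :
    d% (fun p ↦ ⟪tensionField I J φ p, tensionField I J φ p⟫_ℝ) x u = 0 := by
  have hd := (smoothAlong_tensionField hφ.contMDiff x).diffAlong (by simp)
  obtain ⟨w, hw⟩ := htan
  rw [mvfderiv_inner hd hd, hw, real_inner_comm, hφ.inner_tensionField_mfderiv, add_zero]

/-- The normal part of the second covariant derivative of the tension field. -/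
theorem IsIsometricImmersion.secondCov_tensionField_normal (hφ : IsIsometricImmersion I J φ)
    (htan : ∀ (p : M) (u : TangentSpace I p),
      ∃ w, pullbackCov I J φ (tensionField I J φ) p u = mfderiv I J φ p w)
    {k : ℕ} (hk : k = Module.finrank ℝ E) {b : Fin k → TangentSpace I x} (hb : Orthonormal ℝ b)
    (hY : SmoothField ∞ Y x) {ν : TangentSpace J (φ x)}
    (hν : ∀ w, ⟪mfderiv I J φ x w, ν⟫_ℝ = 0) :
    ⟪secondCov I J φ (tensionField I J φ) X Y x, ν⟫_ℝ =
      - ∑ j, ⟪tensionField I J φ x, secondFundamentalForm I J φ x (Y x) (b j)⟫_ℝ *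
        ⟪secondFundamentalForm I J φ x (X x) (b j), ν⟫_ℝ := by
  obtain ⟨e, he, heb, hon⟩ := exists_orthonormal_frame b hb
  let c (j : Fin k) (p : M) : ℝ :=
    - ⟪tensionField I J φ p, secondFundamentalForm I J φ p (Y p) (e j p)⟫_ℝ
  have hc (j) : ContMDiffAt I 𝓘(ℝ) ∞ (c j) x :=
    ContMDiffAt.neg (SmoothAlong.inner (k := ⊤) (smoothAlong_tensionField hφ.contMDiff x)
      (SmoothAlong.secondFundamentalForm hφ.contMDiff hY (he j)))
  have hW : SmoothField ∞ (fun p ↦ ∑ j, c j p • e j p) x :=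
    SmoothAlong.sum Finset.univ contMDiffAt_id fun j _ ↦ (he j).smul (hc j)
  have hev : ∀ᶠ p in 𝓝 x, pullbackCov I J φ (tensionField I J φ) p (Y p) =
      mfderiv I J φ p (∑ j, c j p • e j p) := by
    filter_upwards [hon] with p hp
    obtain ⟨w, hw⟩ := htan p (Y p)
    rw [hw]
    congr 1
    rw [← sum_inner_smul_of_orthonormal hp hk w]
    refine Finset.sum_congr rfl fun j _ ↦ ?_
    congr 1
    rw [← hφ.inner_mfderiv, ← hw, real_inner_comm, hφ.inner_pullbackCov_tensionField]
  obtain ⟨w, hw⟩ := htan x (leviCivita Y x (X x))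
  rw [secondCov, pullbackCov_congr hev, pullbackCov_mfderiv hφ.contMDiff (hW.of_le (by norm_cast)),
    hw, inner_sub_left, inner_add_left, hν, hν, add_zero, sub_zero]
  have hs := map_sum (secondFundamentalBilin hφ.contMDiff x (X x))
    (fun j ↦ c j x • e j x) Finset.univ
  change secondFundamentalForm I J φ x (X x) (∑ j, c j x • e j x) = _ at hs
  rw [hs, sum_inner, ← Finset.sum_neg_distrib]
  refine Finset.sum_congr rfl fun j _ ↦ ?_
  rw [map_smul, inner_smul_left]
  simp only [c, heb, conj_trivial, neg_mul]
  rfl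

/-- The tangential part of the second covariant derivative of the tension field. -/
theorem IsIsometricImmersion.inner_secondCov_tensionField_mfderiv
    (hφ : IsIsometricImmersion I J φ)
    (htan : ∀ (p : M) (u : TangentSpace I p),
      ∃ w, pullbackCov I J φ (tensionField I J φ) p u = mfderiv I J φ p w)
    (hY : SmoothField ∞ Y x) (hZ : SmoothField ∞ Z x) :
    ⟪secondCov I J φ (tensionField I J φ) X Y x, mfderiv I J φ x (Z x)⟫_ℝ =
      - d% (fun p ↦ ⟪tensionField I J φ p, secondFundamentalForm I J φ p (Y p) (Z p)⟫_ℝ) x (X x) +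
        ⟪tensionField I J φ x, secondFundamentalForm I J φ x (Y x) (leviCivita Z x (X x))⟫_ℝ +
        ⟪tensionField I J φ x, secondFundamentalForm I J φ x (leviCivita Y x (X x)) (Z x)⟫_ℝ := by
  have h := mvfderiv_inner (u := X x)
    (((smoothAlong_tensionField hφ.contMDiff x).pullbackCov hφ.contMDiff hY).diffAlong (by simp))
    ((SmoothAlong.mfderivAt (l := ∞) (hφ.contMDiff x) hZ (by simp)).diffAlong (by simp))
  simp only [hφ.inner_pullbackCov_tensionField] at h
  rw [mvfderiv_fun_neg, pullbackCov_mfderiv hφ.contMDiff (hZ.of_le (by norm_cast)),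
    inner_add_right, hφ.inner_pullbackCov_tensionField] at h
  obtain ⟨w, hw⟩ := htan x (Y x)
  rw [hw, real_inner_comm (secondFundamentalForm I J φ x (X x) (Z x)),
    hφ.inner_secondFundamentalForm] at h
  rw [secondCov, inner_sub_left, hφ.inner_pullbackCov_tensionField]
  simp only [neg_apply] at h
  linarith

theorem IsIsometricImmersion.inner_secondCov_tensionField_comm
    (hφ : IsIsometricImmersion I J φ)
    (htan : ∀ (p : M) (u : TangentSpace I p),
      ∃ w, pullbackCov I J φ (tensionField I J φ) p u = mfderiv I J φ p w)
    (hY : SmoothField ∞ Y x) (hZ : SmoothField ∞ Z x) :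
    ⟪secondCov I J φ (tensionField I J φ) X Y x, mfderiv I J φ x (Z x)⟫_ℝ =
      ⟪secondCov I J φ (tensionField I J φ) X Z x, mfderiv I J φ x (Y x)⟫_ℝ := by
  rw [hφ.inner_secondCov_tensionField_mfderiv htan hY hZ,
    hφ.inner_secondCov_tensionField_mfderiv htan hZ hY,
    secondFundamentalForm_comm hφ.contMDiff (Y x), secondFundamentalForm_comm hφ.contMDiff _ (Z x)]
  simp only [secondFundamentalForm_comm hφ.contMDiff (Y _) (Z _)]
  ring

/-- The divergence of the shape operator of a parallel tension field in the frame directions. -/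
theorem IsIsometricImmersion.sum_inner_secondCov_tensionField_frame
    (hφ : IsIsometricImmersion I J φ)
    (htan : ∀ (p : M) (u : TangentSpace I p),
      ∃ w, pullbackCov I J φ (tensionField I J φ) p u = mfderiv I J φ p w)
    {k : ℕ} (hk : k = Module.finrank ℝ E) {e : Fin k → ∀ p : M, TangentSpace I p}
    (he : ∀ i, SmoothField ∞ (e i) x) (hon : ∀ᶠ p in 𝓝 x, Orthonormal ℝ fun i ↦ e i p) :
    ∑ i, ⟪secondCov I J φ (tensionField I J φ) Z (e i) x, mfderiv I J φ x (e i x)⟫_ℝ = 0 := by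
  let β (u v : TangentSpace I x) : ℝ :=
    ⟪tensionField I J φ x, secondFundamentalForm I J φ x u v⟫_ℝ
  have hβ (u v) : β u v = β v u := by
    simp only [β, secondFundamentalForm_comm hφ.contMDiff u v]
  have hd : ∑ i, d% (fun p ↦ ⟪tensionField I J φ p,
      secondFundamentalForm I J φ p (e i p) (e i p)⟫_ℝ) x (Z x) = 0 := by
    rw [← hφ.mvfderiv_norm_sq_tensionField (htan x (Z x))]
    have h : (fun p ↦ ⟪tensionField I J φ p, tensionField I J φ p⟫_ℝ) =ᶠ[𝓝 x]
        fun p ↦ ∑ i, ⟪tensionField I J φ p,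
          secondFundamentalForm I J φ p (e i p) (e i p)⟫_ℝ := by
      filter_upwards [hon] with p hp
      rw [← inner_sum, ← tensionField_eq hφ.contMDiff (sum_inner_smul_of_orthonormal hp hk)]
    rw [mvfderiv_congr h, mvfderiv_fun_sum fun i _ ↦ DiffAlong.inner
      ((smoothAlong_tensionField hφ.contMDiff x).diffAlong (by simp))
      ((SmoothAlong.secondFundamentalForm hφ.contMDiff (he i) (he i)).diffAlong (by simp))]
    simp
  have hanti (i j : Fin k) : ⟪leviCivita (e i) x (Z x), e j x⟫_ℝ =
      - ⟪leviCivita (e j) x (Z x), e i x⟫_ℝ := by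
    have h := mvfderiv_inner_field (u := Z x) ((he i).diffAlong (by simp))
      ((he j).diffAlong (by simp))
    have hc : (fun p ↦ ⟪e i p, e j p⟫_ℝ) =ᶠ[𝓝 x] fun _ ↦ if i = j then (1 : ℝ) else 0 := by
      filter_upwards [hon] with p hp
      exact orthonormal_iff_ite.1 hp i j
    rw [mvfderiv_congr hc, mvfderiv_const, zero_apply, real_inner_comm _ (e i x)] at h
    linarith
  have hz : ∑ i, β (e i x) (leviCivita (e i) x (Z x)) = 0 := by
    have hexp (i : Fin k) : β (e i x) (leviCivita (e i) x (Z x)) =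
        ∑ j, ⟪leviCivita (e i) x (Z x), e j x⟫_ℝ * β (e i x) (e j x) := by
      have hs := map_sum (secondFundamentalBilin hφ.contMDiff x (e i x))
        (fun j ↦ ⟪e j x, leviCivita (e i) x (Z x)⟫_ℝ • e j x) Finset.univ
      rw [sum_inner_smul_of_orthonormal hon.self_of_nhds hk] at hs
      simp only [β]
      change secondFundamentalForm I J φ x (e i x) _ = _ at hs
      rw [hs, inner_sum]
      refine Finset.sum_congr rfl fun j _ ↦ ?_
      rw [map_smul, inner_smul_right, real_inner_comm (e j x)]
      rfl
    have h : ∑ i, β (e i x) (leviCivita (e i) x (Z x)) =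
        - ∑ i, β (e i x) (leviCivita (e i) x (Z x)) := by
      simp only [hexp]
      conv_lhs => rw [Finset.sum_comm]
      rw [← Finset.sum_neg_distrib]
      refine Finset.sum_congr rfl fun i _ ↦ ?_
      rw [← Finset.sum_neg_distrib]
      refine Finset.sum_congr rfl fun j _ ↦ ?_
      rw [hanti j i, hβ (e j x), neg_mul]
    linarith
  have hterm (i : Fin k) := hφ.inner_secondCov_tensionField_mfderiv htan (X := Z) (he i) (he i)
  simp only [secondFundamentalForm_comm hφ.contMDiff (leviCivita (e _) x (Z x))] at hterm
  simp only [hterm, Finset.sum_add_distrib, Finset.sum_neg_distrib, hd]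
  change -0 + ∑ i, β (e i x) (leviCivita (e i) x (Z x)) +
    ∑ i, β (e i x) (leviCivita (e i) x (Z x)) = 0
  rw [hz]
  simp

/-- The tangential part of the rough Laplacian of a parallel tension field. -/
theorem IsIsometricImmersion.inner_roughLaplacian_mfderiv (hφ : IsIsometricImmersion I J φ)
    (htan : ∀ (p : M) (u : TangentSpace I p),
      ∃ w, pullbackCov I J φ (tensionField I J φ) p u = mfderiv I J φ p w)
    (z : TangentSpace I x) :
    ⟪roughLaplacian I J φ (tensionField I J φ) x, mfderiv I J φ x z⟫_ℝ =
      - ⟪curvatureTrace I J φ (tensionField I J φ) x, mfderiv I J φ x z⟫_ℝ := by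
  obtain ⟨e, he, heb, hon⟩ := exists_orthonormal_frame (tangentONB (J := I) x)
    (tangentONB (J := I) x).orthonormal
  have hτ := smoothAlong_tensionField hφ.contMDiff x
  have hz := smoothAlong_extend (F := E) z
  have hz' : FiberBundle.extend E z x = z := FiberBundle.extend_apply_self E z
  have h0 := hφ.sum_inner_secondCov_tensionField_frame htan (Z := FiberBundle.extend E z)
    (k := Module.finrank ℝ (TangentSpace I x)) rfl he hon
  simp only [roughLaplacian, curvatureTrace, inner_neg_left, sum_inner]
  congr 1
  rw [← add_zero (∑ i, ⟪curvature _ _ _ _, _⟫_ℝ), ← h0, ← Finset.sum_add_distrib]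
  refine Finset.sum_congr rfl fun i _ ↦ ?_
  have hei := smoothAlong_extend (F := E) (tangentONB (J := I) x i)
  have hexi : FiberBundle.extend E (tangentONB (J := I) x i) x = e i x := by
    rw [FiberBundle.extend_apply_self, heb]
  rw [secondCov_congr hφ.contMDiff hτ hei (he i) (he i) hexi hexi]
  have hsymm : ⟪secondCov I J φ (tensionField I J φ) (e i) (e i) x, mfderiv I J φ x z⟫_ℝ =
      ⟪secondCov I J φ (tensionField I J φ) (e i) (FiberBundle.extend E z) x,
        mfderiv I J φ x (e i x)⟫_ℝ := by
    conv_lhs => rw [← hz']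
    exact hφ.inner_secondCov_tensionField_comm htan (he i) hz
  rw [hsymm, secondCov_eq_add_curvature hφ.contMDiff hτ (he i) hz, inner_add_left, hz',
    inner_curvature_pair, add_comm, heb]

end ParallelTension

theorem sum_sum_smul_eq_of_parseval {ι κ V G : Type*} [Fintype ι] [Fintype κ]
    [NormedAddCommGroup V] [InnerProductSpace ℝ V] [AddCommGroup G] [Module ℝ G]
    (B : V →ₗ[ℝ] V →ₗ[ℝ] G) (t : G →ₗ[ℝ] ℝ) {f : ι → V} {g : κ → V}
    (hf : ∀ v, ∑ i, ⟪f i, v⟫_ℝ • f i = v) (hg : ∀ v, ∑ j, ⟪g j, v⟫_ℝ • g j = v) :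
    ∑ i, ∑ j, t (B (f i) (f j)) • B (f i) (f j) =
      ∑ i, ∑ j, t (B (g i) (g j)) • B (g i) (g j) := by
  have key (l : V →ₗ[ℝ] G) : ∑ i, t (l (f i)) • l (f i) = ∑ i, t (l (g i)) • l (g i) :=
    sum_apply_self_eq_of_parseval ((LinearMap.lsmul ℝ G).compl₁₂ (t ∘ₗ l) l) hf hg
  have h1 (i : ι) := key (B (f i))
  have h2 (j : κ) := key (B.flip (g j))
  simp only [LinearMap.flip_apply] at h2
  simp only [h1]
  rw [Finset.sum_comm]
  simp only [h2]
  exact Finset.sum_comm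

section Biharmonic

variable {E : Type*} [NormedAddCommGroup E] [NormedSpace ℝ E] [FiniteDimensional ℝ E]
  {H : Type*} [TopologicalSpace H] {I : ModelWithCorners ℝ E H}
  {M : Type*} [TopologicalSpace M] [ChartedSpace H M] [IsManifold I ∞ M]
  [RiemannianBundle (fun x : M ↦ TangentSpace I x)]
  [IsContMDiffRiemannianBundle I ∞ E (fun x : M ↦ TangentSpace I x)]
  {F : Type*} [NormedAddCommGroup F] [NormedSpace ℝ F] [FiniteDimensional ℝ F]
  {H' : Type*} [TopologicalSpace H'] {J : ModelWithCorners ℝ F H'}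
  {N : Type*} [TopologicalSpace N] [ChartedSpace H' N] [IsManifold J ∞ N]
  [RiemannianBundle (fun y : N ↦ TangentSpace J y)]
  [IsContMDiffRiemannianBundle J ∞ F (fun y : N ↦ TangentSpace J y)]
  {φ : M → N} {x : M}

theorem eq_of_inner_tangent_normal {v w : TangentSpace J (φ x)}
    (ht : ∀ z, ⟪v, mfderiv I J φ x z⟫_ℝ = ⟪w, mfderiv I J φ x z⟫_ℝ)
    (hn : ∀ ν, (∀ z, ⟪mfderiv I J φ x z, ν⟫_ℝ = 0) → ⟪v, ν⟫_ℝ = ⟪w, ν⟫_ℝ) : v = w := by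
  rw [← sub_eq_zero, ← inner_self_eq_zero (𝕜 := ℝ), inner_sub_left, sub_eq_zero]
  refine hn _ fun z ↦ ?_
  rw [real_inner_comm, inner_sub_left, ht, sub_self]

theorem mem_normalSpace_iff {ν : TangentSpace J (φ x)} :
    ν ∈ normalSpace I J φ x ↔ ∀ z, ⟪mfderiv I J φ x z, ν⟫_ℝ = 0 := by
  simp [normalSpace, Submodule.mem_orthogonal]

/-- Orthonormal bases of the tangent space and of the normal space make up an orthonormal basis of
the ambient tangent space. -/
theorem IsIsometricImmersion.sum_inner_smul_tangent_normal (hφ : IsIsometricImmersion I J φ)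
    {ι κ : Type*} [Fintype ι] [Fintype κ] (e : OrthonormalBasis ι ℝ (TangentSpace I x))
    (ξ : OrthonormalBasis κ ℝ (normalSpace I J φ x)) (v : TangentSpace J (φ x)) :
    ∑ i, ⟪mfderiv I J φ x (e i), v⟫_ℝ • mfderiv I J φ x (e i) +
      ∑ j, ⟪(ξ j : TangentSpace J (φ x)), v⟫_ℝ • (ξ j : TangentSpace J (φ x)) = v := by
  have hξ (j : κ) (z : TangentSpace I x) :
      ⟪(ξ j : TangentSpace J (φ x)), mfderiv I J φ x z⟫_ℝ = 0 := by
    rw [real_inner_comm]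
    exact mem_normalSpace_iff.1 (ξ j).2 z
  refine eq_of_inner_tangent_normal (I := I) (fun z ↦ ?_) fun ν hν ↦ ?_
  · have hz := congrArg (mfderiv I J φ x) (e.sum_repr' z)
    rw [map_sum] at hz
    rw [inner_add_left, sum_inner, sum_inner]
    simp only [real_inner_smul_left, hξ, mul_zero, Finset.sum_const_zero, add_zero,
      hφ.inner_mfderiv]
    rw [← hz, inner_sum]
    refine Finset.sum_congr rfl fun i _ ↦ ?_
    rw [map_smul, inner_smul_right, real_inner_comm v]
    exact mul_comm _ _
  · have hν' := congrArg Subtype.val (ξ.sum_repr' ⟨ν, mem_normalSpace_iff.2 hν⟩)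
    simp only [Submodule.coe_inner, Submodule.coe_sum, Submodule.coe_smul] at hν'
    conv_rhs => rw [← hν', inner_sum]
    simp only [inner_add_left, sum_inner, real_inner_smul_left, hν, mul_zero,
      Finset.sum_const_zero, zero_add, inner_smul_right]
    refine Finset.sum_congr rfl fun i _ ↦ ?_
    rw [real_inner_comm v]
    ring

theorem IsIsometricImmersion.ricciTransform_eq (hφ : IsIsometricImmersion I J φ)
    {κ : Type*} [Fintype κ] (ξ : OrthonormalBasis κ ℝ (normalSpace I J φ x))
    (V : ∀ p, TangentSpace J (φ p)) :
    ricciTransform (φ x) (V x) = curvatureTrace I J φ V x +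
      ∑ j, curvature (φ x) (V x) (ξ j) (ξ j) := by
  have h := sum_apply_self_eq_of_parseval (curvatureBilin (φ x) (V x))
    (fun v ↦ (tangentONB (J := J) (φ x)).sum_repr' v)
    (g := Sum.elim (fun i ↦ mfderiv I J φ x (tangentONB x i))
      (fun j ↦ (ξ j : TangentSpace J (φ x)))) fun v ↦ by
        rw [Fintype.sum_sum_type]
        exact hφ.sum_inner_smul_tangent_normal (tangentONB x) ξ v
  rw [Fintype.sum_sum_type] at h
  exact h

theorem IsIsometricImmersion.inner_roughLaplacian_normal (hφ : IsIsometricImmersion I J φ)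
    (htan : ∀ (p : M) (u : TangentSpace I p),
      ∃ w, pullbackCov I J φ (tensionField I J φ) p u = mfderiv I J φ p w)
    {ν : TangentSpace J (φ x)} (hν : ∀ w, ⟪mfderiv I J φ x w, ν⟫_ℝ = 0) :
    ⟪roughLaplacian I J φ (tensionField I J φ) x, ν⟫_ℝ =
      ⟪∑ j, ∑ k, ⟪tensionField I J φ x,
        secondFundamentalForm I J φ x (tangentONB x j) (tangentONB x k)⟫_ℝ •
        secondFundamentalForm I J φ x (tangentONB x j) (tangentONB x k), ν⟫_ℝ := by
  simp only [roughLaplacian, inner_neg_left, sum_inner, ← Finset.sum_neg_distrib,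
    real_inner_smul_left]
  refine Finset.sum_congr rfl fun i _ ↦ ?_
  rw [hφ.secondCov_tensionField_normal htan (k := Module.finrank ℝ (TangentSpace I x)) rfl
    (tangentONB (J := I) x).orthonormal (smoothAlong_extend _) hν, neg_neg,
    FiberBundle.extend_apply_self]

/-- For a parallel tension field the bitension equation decouples into an algebraic one. -/
theorem IsIsometricImmersion.bitensionField_eq_zero_iff (hφ : IsIsometricImmersion I J φ)
    (htan : ∀ (p : M) (u : TangentSpace I p),
      ∃ w, pullbackCov I J φ (tensionField I J φ) p u = mfderiv I J φ p w)
    {ι : Type*} [Fintype ι] (e : OrthonormalBasis ι ℝ (TangentSpace I x)) :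
    bitensionField I J φ x = 0 ↔ curvatureTrace I J φ (tensionField I J φ) x =
      ∑ j, ∑ k, ⟪tensionField I J φ x, secondFundamentalForm I J φ x (e j) (e k)⟫_ℝ •
        secondFundamentalForm I J φ x (e j) (e k) := by
  have hQ := sum_sum_smul_eq_of_parseval (secondFundamentalBilin hφ.contMDiff x)
    (innerₗ (TangentSpace J (φ x)) (tensionField I J φ x)) (fun v ↦ e.sum_repr' v)
    (fun v ↦ (tangentONB (J := I) x).sum_repr' v)
  have hQ' : ∑ j, ∑ k, ⟪tensionField I J φ x, secondFundamentalForm I J φ x (e j) (e k)⟫_ℝ •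
        secondFundamentalForm I J φ x (e j) (e k) =
      ∑ j, ∑ k, ⟪tensionField I J φ x,
        secondFundamentalForm I J φ x (tangentONB x j) (tangentONB x k)⟫_ℝ •
        secondFundamentalForm I J φ x (tangentONB x j) (tangentONB x k) := hQ
  have hQt (z : TangentSpace I x) : ⟪∑ j, ∑ k, ⟪tensionField I J φ x,
      secondFundamentalForm I J φ x (e j) (e k)⟫_ℝ •
      secondFundamentalForm I J φ x (e j) (e k), mfderiv I J φ x z⟫_ℝ = 0 := by
    simp [sum_inner, real_inner_smul_left, hφ.inner_secondFundamentalForm]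
  have ht (z : TangentSpace I x) := hφ.inner_roughLaplacian_mfderiv htan z
  have hn {ν : TangentSpace J (φ x)} (hν : ∀ z, ⟪mfderiv I J φ x z, ν⟫_ℝ = 0) :=
    hφ.inner_roughLaplacian_normal htan hν
  rw [← hQ'] at hn
  rw [bitensionField, sub_eq_zero]
  constructor
  · intro h
    refine eq_of_inner_tangent_normal (I := I) (fun z ↦ ?_) fun ν hν ↦ by rw [← h, hn hν]
    have := ht z
    rw [h] at this
    rw [hQt]
    linarith
  · intro h
    rw [h]
    refine eq_of_inner_tangent_normal (I := I) (fun z ↦ ?_) fun ν hν ↦ hn hν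
    rw [ht, h, hQt, neg_zero]

end Biharmonic

end

end RiemannianImmersion


theorem theorem3p5 {m n : ℕ}
    {M : Type*} [TopologicalSpace M] [T2Space M] [ChartedSpace (EuclideanSpace ℝ (Fin m)) M]
    [IsManifold (𝓡 m) ∞ M] [RiemannianBundle (fun x : M ↦ TangentSpace (𝓡 m) x)]
    [IsContMDiffRiemannianBundle (𝓡 m) ∞ (EuclideanSpace ℝ (Fin m))
      (fun x : M ↦ TangentSpace (𝓡 m) x)]
    {N : Type*} [TopologicalSpace N] [ChartedSpace (EuclideanSpace ℝ (Fin n)) N]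
    [IsManifold (𝓡 n) ∞ N] [RiemannianBundle (fun y : N ↦ TangentSpace (𝓡 n) y)]
    [IsContMDiffRiemannianBundle (𝓡 n) ∞ (EuclideanSpace ℝ (Fin n))
      (fun y : N ↦ TangentSpace (𝓡 n) y)]
    (φ : M → N) (hφ : IsIsometricImmersion (𝓡 m) (𝓡 n) φ)
    (hpar : HasParallelTension (𝓡 m) (𝓡 n) φ)
    (e : ∀ x : M, OrthonormalBasis (Fin m) ℝ (TangentSpace (𝓡 m) x))
    (ξ : ∀ x : M, OrthonormalBasis (Fin (n - m)) ℝ (normalSpace (𝓡 m) (𝓡 n) φ x)) :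
    (IsBiharmonic (𝓡 m) (𝓡 n) φ ↔ ∀ x : M,
      ricciTransform (φ x) (tensionField (𝓡 m) (𝓡 n) φ x)
        - ∑ i, curvature (φ x) (tensionField (𝓡 m) (𝓡 n) φ x) (ξ x i) (ξ x i)
      = ∑ j, ∑ k, ⟪tensionField (𝓡 m) (𝓡 n) φ x,
            secondFundamentalForm (𝓡 m) (𝓡 n) φ x (e x j) (e x k)⟫_ℝ
          • secondFundamentalForm (𝓡 m) (𝓡 n) φ x (e x j) (e x k)) ∧
    ∀ c : ℝ, (∀ (y : N) (u : TangentSpace (𝓡 n) y), ricciTransform y u = c • u) →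
      (IsBiharmonic (𝓡 m) (𝓡 n) φ ↔ ∀ x : M,
        c • tensionField (𝓡 m) (𝓡 n) φ x
          - ∑ i, curvature (φ x) (tensionField (𝓡 m) (𝓡 n) φ x) (ξ x i) (ξ x i)
        = ∑ j, ∑ k, ⟪tensionField (𝓡 m) (𝓡 n) φ x,
              secondFundamentalForm (𝓡 m) (𝓡 n) φ x (e x j) (e x k)⟫_ℝ
            • secondFundamentalForm (𝓡 m) (𝓡 n) φ x (e x j) (e x k)) := by

  have htan := hpar.exists_mfderiv_eq
  have key : IsBiharmonic (𝓡 m) (𝓡 n) φ ↔ ∀ x : M,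
      ricciTransform (φ x) (tensionField (𝓡 m) (𝓡 n) φ x)
        - ∑ i, curvature (φ x) (tensionField (𝓡 m) (𝓡 n) φ x) (ξ x i) (ξ x i)
      = ∑ j, ∑ k, ⟪tensionField (𝓡 m) (𝓡 n) φ x,
            secondFundamentalForm (𝓡 m) (𝓡 n) φ x (e x j) (e x k)⟫_ℝ
          • secondFundamentalForm (𝓡 m) (𝓡 n) φ x (e x j) (e x k) := by
    refine forall_congr' fun x ↦ ?_
    rw [hφ.bitensionField_eq_zero_iff htan (e x), hφ.ricciTransform_eq (ξ x), add_sub_cancel_right]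
  refine ⟨key, fun c hc ↦ ?_⟩
  simpa only [hc] using key
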